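/- All graphs are finite and simple. A hole of a graph $G$ is an induced cycle of $G$ of length at least $4$, and it is odd if its length is odd. For an integer $l\ge 2$ let $\mathcal G_l$ be the family of graphs of girth exactly $2l+1$ (the girth being the minimum length of a cycle) that have no odd hole of length at least $2l+3$. A graph $G$ is $4$-vertex-critical if $\chi(G)=4$ and $\chi(G-v)<4$ for every vertex $v$ of $G$. A $K_4$-subdivision in $G$ is a (not necessarily induced) subgraph $H$ of $G$ consisting of four distinct vertices $u_1,u_2,u_3,u_4$ and six paths of $G$, namely a $(u_1,u_2)$-path $P_1$, a $(u_3,u_4)$-path $P_2$, a $(u_2,u_3)$-path $Q_1$, a $(u_1,u_4)$-path $Q_2$, a $(u_1,u_3)$-path $L_1$ and a $(u_2,u_4)$-path $L_2$, any two of which have no vertex in common except a common end. Its face cycles are $C_1=P_1\cup Q_1\cup L_1$, $C_2=P_1\cup Q_2\cup L_2$, $C_3=P_2\cup Q_1\cup L_2$ and $C_4=P_2\cup Q_2\cup L_1$. It is an odd $K_4$-subdivision in $G$ if $C_1,C_2,C_3,C_4$ are all odd holes of $G$. **Theorem.** Let $l\ge 4$ be an integer and let $G\in\mathcal G_l$.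 If $G$ is $4$-vertex-critical, then $G$ has no odd $K_4$-subdivision. -/

import Mathlib

namespace OddK4

variable {V : Type*} {G : SimpleGraph V}

/-- A hole of `G`: an induced (i.e. chordless in `G`) cycle of length at least `4`. -/
def IsHole {v : V} (C : G.Walk v v) : Prop :=
  C.IsCycle ∧ C.IsChordless ∧ 4 ≤ C.length

/-- An odd hole of `G`: a hole of odd length. -/
def IsOddHole {v : V} (C : G.Walk v v) : Prop :=
  IsHole C ∧ Odd C.length

/-- The family `𝒢_l`: graphs of girth `2l + 1` without odd holes of length at least `2l + 3`. -/
def InFamily (l : ℕ) (G : SimpleGraph V) : Prop :=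
  G.egirth = ((2 * l + 1 : ℕ) : ℕ∞) ∧
    ∀ (v : V) (C : G.Walk v v), IsOddHole C → ¬ 2 * l + 3 ≤ C.length

/-- `G` is `k`-vertex-critical: `χ(G) = k` and `χ(G - v) < k` for every vertex `v`. -/
def IsVertexCritical (k : ℕ) (G : SimpleGraph V) : Prop :=
  G.chromaticNumber = (k : ℕ∞) ∧
    ∀ v : V, (G.induce {v}ᶜ).chromaticNumber < (k : ℕ∞)

/-- A (not necessarily induced) subgraph of `G` that is a subdivision of `K₄`, given by its four
branch vertices and the six arrises joining them: paths of `G` that meet only in common ends. -/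
structure K4Subdivision (G : SimpleGraph V) where
  /-- branch vertices -/
  u₁ : V
  u₂ : V
  u₃ : V
  u₄ : V
  /-- arrises -/
  P₁ : G.Walk u₁ u₂
  P₂ : G.Walk u₃ u₄
  Q₁ : G.Walk u₂ u₃
  Q₂ : G.Walk u₁ u₄
  L₁ : G.Walk u₁ u₃
  L₂ : G.Walk u₂ u₄
  /-- the branch vertices are distinct -/
  nodup : [u₁, u₂, u₃, u₄].Nodup
  /-- the arrises are paths -/
  isPath_P₁ : P₁.IsPath
  isPath_P₂ : P₂.IsPath
  isPath_Q₁ : Q₁.IsPath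
  isPath_Q₂ : Q₂.IsPath
  isPath_L₁ : L₁.IsPath
  isPath_L₂ : L₂.IsPath
  /-- opposite arrises are vertex disjoint -/
  disj_P : ∀ x ∈ P₁.support, x ∉ P₂.support
  disj_Q : ∀ x ∈ Q₁.support, x ∉ Q₂.support
  disj_L : ∀ x ∈ L₁.support, x ∉ L₂.support
  /-- arrises at `u₁` meet only in `u₁` -/
  meet_P₁_Q₂ : ∀ x ∈ P₁.support, x ∈ Q₂.support → x = u₁
  meet_P₁_L₁ : ∀ x ∈ P₁.support, x ∈ L₁.support → x = u₁
  meet_Q₂_L₁ : ∀ x ∈ Q₂.support, x ∈ L₁.support → x = u₁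
  /-- arrises at `u₂` meet only in `u₂` -/
  meet_P₁_Q₁ : ∀ x ∈ P₁.support, x ∈ Q₁.support → x = u₂
  meet_P₁_L₂ : ∀ x ∈ P₁.support, x ∈ L₂.support → x = u₂
  meet_Q₁_L₂ : ∀ x ∈ Q₁.support, x ∈ L₂.support → x = u₂
  /-- arrises at `u₃` meet only in `u₃` -/
  meet_P₂_Q₁ : ∀ x ∈ P₂.support, x ∈ Q₁.support → x = u₃
  meet_P₂_L₁ : ∀ x ∈ P₂.support, x ∈ L₁.support → x = u₃
  meet_Q₁_L₁ : ∀ x ∈ Q₁.support, x ∈ L₁.support → x = u₃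
  /-- arrises at `u₄` meet only in `u₄` -/
  meet_P₂_Q₂ : ∀ x ∈ P₂.support, x ∈ Q₂.support → x = u₄
  meet_P₂_L₂ : ∀ x ∈ P₂.support, x ∈ L₂.support → x = u₄
  meet_Q₂_L₂ : ∀ x ∈ Q₂.support, x ∈ L₂.support → x = u₄

namespace K4Subdivision

/-- The face cycle `C₁ = P₁ ∪ Q₁ ∪ L₁`, traversed `u₁ u₂ u₃ u₁`. -/
def C₁ (H : K4Subdivision G) : G.Walk H.u₁ H.u₁ :=
  (H.P₁.append H.Q₁).append H.L₁.reverse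

/-- The face cycle `C₂ = P₁ ∪ Q₂ ∪ L₂`, traversed `u₁ u₂ u₄ u₁`. -/
def C₂ (H : K4Subdivision G) : G.Walk H.u₁ H.u₁ :=
  (H.P₁.append H.L₂).append H.Q₂.reverse

/-- The face cycle `C₃ = P₂ ∪ Q₁ ∪ L₂`, traversed `u₃ u₄ u₂ u₃`. -/
def C₃ (H : K4Subdivision G) : G.Walk H.u₃ H.u₃ :=
  (H.P₂.append H.L₂.reverse).append H.Q₁

/-- The face cycle `C₄ = C₁ △ C₂ △ C₃ = P₂ ∪ Q₂ ∪ L₁`, traversed `u₁ u₃ u₄ u₁`. -/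
def C₄ (H : K4Subdivision G) : G.Walk H.u₁ H.u₁ :=
  (H.L₁.append H.P₂).append H.Q₂.reverse

/-- `H` is an odd `K₄`-subdivision of `G`: its four face cycles are odd holes of `G`. -/
def IsOdd (H : K4Subdivision G) : Prop :=
  IsOddHole H.C₁ ∧ IsOddHole H.C₂ ∧ IsOddHole H.C₃ ∧ IsOddHole H.C₄

end K4Subdivision

end OddK4

/-!
Let `H` be an odd `K₄`-subdivision of `G ∈ 𝒢_l`. All odd holes of `G` have length `2l + 1`, so the
four face cycles do, and opposite arrises have equal lengths `p`, `q`, `r` with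
`p + q + r = 2l + 1`. By the girth `2l + 1` each of the three lengths is at most `l`, the
subgraph `H` is induced, and no vertex outside `H` has two neighbours in it. The proof works with
`H` in this form, indexed symmetrically by `Fin 4` (`Frame`, `K4Subdivision.nonempty_frame`).

The main tool is the notion of a jump: an induced path `R` with nonadjacent ends `s`, `t` in `H` and
inner vertices outside `H` that see little of `H` (`Frame.Jump`). Each induced path of `H` from `s`
to `t` that, apart from `s` and `t`, avoids the neighbours of the inner vertices of `R` closes `R`
to a hole, which has length `2l + 1` if it is odd (`Jump.odd_one` to `Jump.odd_four`), while every
path of `H` from `s` to `t` together with `R` has length at least `2l + 1` (`Jump.le_length`).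
Comparing the paths of different parity through one, two, three or four branch vertices excludes
nearly all positions of `s` and `t` (`Jump.no_same`, `Jump.eq_one_of_adjacent`, `Jump.opposite`,
`Jump.no_star`).

On the other hand jumps exist. A 4-vertex-critical graph in `𝒢_l` has minimum degree at least three
and no cutset inside a path with three vertices (`not_exists_cutset_path`, by Kempe chains). Hence
an inner vertex `v` of an arris has a neighbour `w` outside `H`, and the component of `w` in `G - H`
has further neighbours in `H` besides `v` and its two neighbours in `H`. A shortest path that arises
in this way is a jump, up to one exceptional neighbour `z` of its inner vertices
(`exists_minimal_jump`).

If two of the three lengths are below `l`, all these jumps are impossible (`Frame.false_of_len_lt`).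
Otherwise two lengths are `l` and the third one is `1` (`Frame.false_of_len_eq`). Then a jump
between the interiors of opposite arrises of length `l` has itself length `l`. Adding it to `H` and
deleting an arris of length `l` that joins the two arrises in question gives a `K₄`-subdivision of
the first type (`Jump.false_of_opposite`); the remaining jumps are excluded as before, provided that
the first end of the minimal jump is not a neighbour of a branch vertex.
-/

open SimpleGraph

namespace OddK4

variable {V : Type*} {G : SimpleGraph V}

/-! ### Induced paths, girth and holes -/

theorem isPath_append {a b c : V} {p : G.Walk a b} {q : G.Walk b c} (hp : p.IsPath)
    (hq : q.IsPath) (h : ∀ x ∈ p.support, x ∈ q.support → x = b) : (p.append q).IsPath := by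
  refine Walk.IsPath.mk' ?_
  rw [Walk.support_append, List.nodup_append']
  refine ⟨hp.support_nodup, hq.support_nodup.tail, fun x hx hx' => ?_⟩
  obtain rfl := h x hx (List.mem_of_mem_tail hx')
  have := hq.support_nodup
  rw [← Walk.cons_tail_support] at this
  exact (List.nodup_cons.1 this).1 hx'

/-- An induced path of `G`. -/
def IsIndPath {a b : V} (p : G.Walk a b) : Prop :=
  p.IsPath ∧ p.IsChordless

theorem IsIndPath.mem_edges {a b : V} {p : G.Walk a b} (h : IsIndPath p) {x y : V}
    (hx : x ∈ p.support) (hy : y ∈ p.support) (hxy : G.Adj x y) : s(x, y) ∈ p.edges :=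
  h.2.mem_edges hx hy hxy

theorem IsIndPath.eq_succ_or {a b : V} {p : G.Walk a b} (h : IsIndPath p) {m n : ℕ}
    (hm : m ≤ p.length) (hn : n ≤ p.length) (hmn : G.Adj (p.getVert m) (p.getVert n)) :
    n = m + 1 ∨ m = n + 1 := by
  obtain ⟨k, hk⟩ := (p.mk_mem_edges_iff_exists).1
    (h.mem_edges (p.getVert_mem_support m) (p.getVert_mem_support n) hmn)
  have inj := h.1.getVert_injOn
  grind [Set.InjOn]

theorem IsIndPath.reverse {a b : V} {p : G.Walk a b} (h : IsIndPath p) : IsIndPath p.reverse := by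
  refine ⟨h.1.reverse, Walk.isChordless_iff_forall_mem_edges.2 fun x y hx hy hxy => ?_⟩
  simp only [Walk.support_reverse, List.mem_reverse, Walk.edges_reverse] at *
  exact h.mem_edges hx hy hxy

theorem IsIndPath.of_append_left {a b c : V} {p : G.Walk a b} {q : G.Walk b c}
    (h : IsIndPath (p.append q)) : IsIndPath p := by
  refine ⟨h.1.of_append_left, Walk.isChordless_iff_forall_mem_edges.2 fun x y hx hy hxy => ?_⟩
  have he := h.mem_edges (Walk.support_subset_support_append_left _ _ hx)
    (Walk.support_subset_support_append_left _ _ hy) hxy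
  rw [Walk.edges_append, List.mem_append] at he
  refine he.resolve_right fun hq => ?_
  have hxq := q.fst_mem_support_of_mem_edges hq
  have hyq := q.snd_mem_support_of_mem_edges hq
  by_cases hxb : x = b
  · have hyb : y ≠ b := fun hyb => hxy.ne (hxb.trans hyb.symm)
    exact h.1.ne_of_mem_support_of_append hyb hy hyq rfl
  · exact h.1.ne_of_mem_support_of_append hxb hx hxq rfl

/-- Two induced paths concatenate to an induced path if the only contact between the first path
and the rest of the second one is at the junction. -/
theorem IsIndPath.append {a b c : V} {p : G.Walk a b} {q : G.Walk b c} (hp : IsIndPath p)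
    (hq : IsIndPath q)
    (h : ∀ x ∈ p.support, ∀ y ∈ q.support, y ≠ b → x ≠ y ∧ (G.Adj x y → x = b)) :
    IsIndPath (p.append q) := by
  constructor
  · refine isPath_append hp.1 hq.1 fun x hx hy => ?_
    by_contra hxb
    exact (h x hx x hy hxb).1 rfl
  · have key : ∀ x ∈ p.support, ∀ y ∈ q.support, G.Adj x y → s(x, y) ∈ (p.append q).edges := by
      intro x hx y hy hxy
      rw [Walk.edges_append, List.mem_append]
      by_cases hyb : y = b
      · subst hyb
        exact Or.inl (hp.mem_edges hx p.end_mem_support hxy)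
      · have := (h x hx y hy hyb).2 hxy
        subst this
        exact Or.inr (hq.mem_edges q.start_mem_support hy hxy)
    refine Walk.isChordless_iff_forall_mem_edges.2 fun x y hx hy hxy => ?_
    rw [Walk.mem_support_append_iff] at hx hy
    rcases hx with hx | hx <;> rcases hy with hy | hy
    · rw [Walk.edges_append, List.mem_append]
      exact Or.inl (hp.mem_edges hx hy hxy)
    · exact key x hx y hy hxy
    · rw [Sym2.eq_swap]
      exact key y hy x hx hxy.symm
    · rw [Walk.edges_append, List.mem_append]
      exact Or.inr (hq.mem_edges hx hy hxy)

/-- A path and a walk with the same ends that avoids some vertex of the path enclose a cycle. -/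
theorem le_length_add_length {g : ℕ} (hg : (g : ℕ∞) ≤ G.egirth) {a b : V} {p : G.Walk a b}
    (hp : p.IsPath) (q : G.Walk a b) {x : V} (hx : x ∈ p.support) (hxq : x ∉ q.support) :
    g ≤ p.length + q.length := by
  classical
  obtain ⟨w, -, -, c, hc, hle⟩ := hp.exists_isCycle_length_le_add_of_ne q.bypass_isPath
    (fun h => hxq (q.support_bypass_subset_support (h ▸ hx)))
  have h1 : (g : ℕ∞) ≤ c.length := hg.trans (egirth_le_length hc)
  have h2 : g ≤ c.length := by exact_mod_cast h1
  have := q.length_bypass_le_length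
  omega

/-- Two induced paths with common nonadjacent ends and no further contact form a hole. -/
theorem isHole_append_reverse {a b : V} {p q : G.Walk a b} (hp : IsIndPath p) (hq : IsIndPath q)
    (hab : a ≠ b) (nab : ¬ G.Adj a b)
    (h : ∀ x ∈ p.support, x ≠ a → x ≠ b →
      x ∉ q.support ∧ ∀ y ∈ q.support, G.Adj x y → y = a ∨ y = b) :
    IsHole (p.append q.reverse) := by
  have two : ∀ r : G.Walk a b, 2 ≤ r.length := by
    intro r
    cases r with
    | nil => exact absurd rfl hab
    | cons h1 r => cases r with
      | nil => exact absurd h1 nab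
      | cons h2 r => simp
  have h2p := two p
  have h2q := two q
  refine ⟨?_, ?_, by simp; omega⟩
  · refine hp.1.isCycle_append hq.1.reverse (fun x hx hy => ?_) (Or.inl (by omega))
    have hxa : x ≠ a := by
      rintro rfl
      have := hp.1.support_nodup
      rw [← Walk.cons_tail_support] at this
      exact (List.nodup_cons.1 this).1 hx
    have hxb : x ≠ b := by
      rintro rfl
      have := hq.1.reverse.support_nodup
      rw [← Walk.cons_tail_support] at this
      exact (List.nodup_cons.1 this).1 hy
    refine (h x (List.mem_of_mem_tail hx) hxa hxb).1 ?_
    have := List.mem_of_mem_tail hy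
    simpa using this
  · have key : ∀ x ∈ p.support, ∀ y ∈ q.support, G.Adj x y →
        s(x, y) ∈ (p.append q.reverse).edges := by
      intro x hx y hy hxy
      rw [Walk.edges_append, List.mem_append, Walk.edges_reverse, List.mem_reverse]
      by_cases hxa : x = a
      · subst hxa
        exact Or.inr (hq.mem_edges q.start_mem_support hy hxy)
      by_cases hxb : x = b
      · subst hxb
        exact Or.inr (hq.mem_edges q.end_mem_support hy hxy)
      rcases (h x hx hxa hxb).2 y hy hxy with rfl | rfl
      · exact Or.inl (hp.mem_edges hx p.start_mem_support hxy)
      · exact Or.inl (hp.mem_edges hx p.end_mem_support hxy)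
    refine Walk.isChordless_iff_forall_mem_edges.2 fun x y hx hy hxy => ?_
    rw [Walk.mem_support_append_iff, Walk.support_reverse, List.mem_reverse] at hx hy
    rcases hx with hx | hx <;> rcases hy with hy | hy
    · rw [Walk.edges_append, List.mem_append]
      exact Or.inl (hp.mem_edges hx hy hxy)
    · exact key x hx y hy hxy
    · rw [Sym2.eq_swap]
      exact key y hy x hx hxy.symm
    · rw [Walk.edges_append, List.mem_append, Walk.edges_reverse, List.mem_reverse]
      exact Or.inr (hq.mem_edges hx hy hxy)

/-- A shortest walk between two vertices through a prescribed set is an induced path. -/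
theorem exists_isIndPath_of_walk {X : Set V} {a b : V} (p : G.Walk a b)
    (hp : ∀ x ∈ p.support, x ∈ X) :
    ∃ q : G.Walk a b, IsIndPath q ∧ (∀ x ∈ q.support, x ∈ X) ∧ q.length ≤ p.length := by
  classical
  have hex : ∃ n, ∃ q : G.Walk a b, (∀ x ∈ q.support, x ∈ X) ∧ q.length = n := ⟨_, p, hp, rfl⟩
  obtain ⟨q, hqX, hq⟩ := Nat.find_spec hex
  have hmin : ∀ r : G.Walk a b, (∀ x ∈ r.support, x ∈ X) → q.length ≤ r.length := by
    intro r hr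
    rw [hq]
    exact Nat.find_min' hex ⟨r, hr, rfl⟩
  have hqp : q.IsPath := by
    have h1 := hmin q.bypass fun x hx => hqX x (q.support_bypass_subset_support hx)
    rw [← q.bypass_eq_self_of_length_le_length_bypass h1]
    exact q.bypass_isPath
  refine ⟨q, ⟨hqp, Walk.isChordless_iff_forall_mem_edges.2 ?_⟩, hqX, hmin p hp⟩
  have key : ∀ m n, m < n → n ≤ q.length → G.Adj (q.getVert m) (q.getVert n) → n = m + 1 := by
    intro m n hmn hn hadj
    have h1 := hmin ((q.take m).append (Walk.cons hadj (q.drop n))) (by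
      intro x hx
      rw [Walk.mem_support_append_iff, Walk.support_cons, List.mem_cons] at hx
      rcases hx with hx | rfl | hx
      · exact hqX x ((q.isSubwalk_take m).support_subset hx)
      · exact hqX _ (q.getVert_mem_support m)
      · exact hqX x ((q.isSubwalk_drop n).support_subset hx))
    simp only [Walk.length_append, Walk.length_cons, Walk.take_length, Walk.drop_length] at h1
    omega
  intro x y hx hy hxy
  obtain ⟨m, rfl, hm⟩ := Walk.mem_support_iff_exists_getVert.1 hx
  obtain ⟨n, rfl, hn⟩ := Walk.mem_support_iff_exists_getVert.1 hy
  rcases lt_trichotomy m n with hlt | rfl | hlt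
  · obtain rfl := key m n hlt hn hxy
    exact q.mk_mem_edges_iff_exists.2 ⟨m, by simp; omega⟩
  · exact absurd hxy (G.loopless.irrefl _)
  · obtain rfl := key n m hlt hm hxy.symm
    exact q.mk_mem_edges_iff_exists.2 ⟨n, by simp; omega⟩

/-- In `𝒢_l` every odd hole has length `2l + 1`. -/
theorem InFamily.length_eq {l : ℕ} (hG : InFamily l G) {v : V} {C : G.Walk v v} (hC : IsHole C)
    (hodd : Odd C.length) : C.length = 2 * l + 1 := by
  have h1 : ((2 * l + 1 : ℕ) : ℕ∞) ≤ C.length := hG.1 ▸ egirth_le_length hC.1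
  have h2 : 2 * l + 1 ≤ C.length := by exact_mod_cast h1
  have h3 := hG.2 v C ⟨hC, hodd⟩
  obtain ⟨k, hk⟩ := hodd
  omega

/-! ### Colourings of 4-vertex-critical graphs -/

/-- `c` is a proper 3-colouring of the subgraph of `G` induced by `B`; the values of `c` outside
`B` are irrelevant. -/
def ColorsOn (G : SimpleGraph V) (c : V → Fin 3) (B : Set V) : Prop :=
  ∀ x ∈ B, ∀ y ∈ B, G.Adj x y → c x ≠ c y

theorem ColorsOn.mono {c : V → Fin 3} {A B : Set V} (h : ColorsOn G c B) (hAB : A ⊆ B) :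
    ColorsOn G c A :=
  fun x hx y hy => h x (hAB hx) y (hAB hy)

theorem IsVertexCritical.not_colorsOn_univ (h : IsVertexCritical 4 G) (c : V → Fin 3) :
    ¬ ColorsOn G c Set.univ := by
  intro hc
  have hcol : G.Colorable 3 := ⟨Coloring.mk c fun {x y} hxy => hc x trivial y trivial hxy⟩
  have h1 := hcol.chromaticNumber_le
  rw [h.1] at h1
  norm_cast at h1

theorem IsVertexCritical.exists_colorsOn (h : IsVertexCritical 4 G) (v : V) :
    ∃ c, ColorsOn G c {v}ᶜ := by
  classical
  have h1 := h.2 v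
  have h2 : (G.induce {v}ᶜ).chromaticNumber ≤ (3 : ℕ) := by
    have : ((4 : ℕ) : ℕ∞) = ((3 : ℕ) : ℕ∞) + 1 := by norm_num
    rw [this] at h1
    exact Order.le_of_lt_add_one h1
  obtain ⟨C⟩ := chromaticNumber_le_iff_colorable.1 h2
  refine ⟨fun x => if hx : x ∈ ({v}ᶜ : Set V) then C ⟨x, hx⟩ else 0, fun x hx y hy hxy => ?_⟩
  simp only [hx, hy, dif_pos]
  exact C.valid (by simpa using hxy)

/-- The minimum degree of a 4-vertex-critical graph is at least 3. -/
theorem IsVertexCritical.exists_adj_ne (h : IsVertexCritical 4 G) (v x y : V) :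
    ∃ w, G.Adj v w ∧ w ≠ x ∧ w ≠ y := by
  classical
  by_contra! hno
  obtain ⟨c, hc⟩ := h.exists_colorsOn v
  obtain ⟨d, hdx, hdy⟩ : ∃ d : Fin 3, d ≠ c x ∧ d ≠ c y := by
    generalize c x = a
    generalize c y = b
    revert a b
    decide
  have key : ∀ w, G.Adj v w → d ≠ c w := by
    intro w hw
    by_cases hwx : w = x
    · exact hwx ▸ hdx
    · exact hno w hw hwx ▸ hdy
  refine h.not_colorsOn_univ (fun w => if w = v then d else c w) fun a _ b _ hab => ?_
  by_cases ha : a = v <;> by_cases hb : b = v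
  · exact absurd (ha.trans hb.symm) hab.ne
  · subst ha
    simpa [hb] using key b hab
  · subst hb
    simpa [ha] using (key a hab.symm).symm
  · simpa [ha, hb] using hc a ha b hb hab

/-- A Kempe change at `s`: either the colouring can be changed so that `s` and `t` switch between
having equal and different colours, or some induced path from `s` to `t` alternates between two
colours that are not the colour of `u`. -/
theorem ColorsOn.kempe {c : V → Fin 3} {B : Set V} (hc : ColorsOn G c B) {s t u : V} (hs : s ∈ B)
    (ht : t ∈ B) (hu : u ∈ B) (hus : G.Adj u s) (hut : G.Adj u t) :
    (∃ c', ColorsOn G c' B ∧ (c' s = c' t ↔ c s ≠ c t)) ∨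
      ∃ q : G.Walk s t, IsIndPath q ∧ (∀ x ∈ q.support, x ∈ B) ∧ u ∉ q.support ∧
        (Even q.length ↔ c s = c t) := by
  classical
  have hcs := hc u hu s hs hus
  have hct := hc u hu t ht hut
  obtain ⟨β, hβs, hβu, hβt⟩ : ∃ β : Fin 3, β ≠ c s ∧ β ≠ c u ∧ (c t = c s ∨ c t = β) := by
    revert hcs hct
    generalize c s = a
    generalize c t = b
    generalize c u = d
    revert a b d
    decide
  set X : Set V := {x | x ∈ B ∧ (c x = c s ∨ c x = β)} with hX
  by_cases hw : ∃ p : G.Walk s t, ∀ x ∈ p.support, x ∈ X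
  · obtain ⟨p, hp⟩ := hw
    obtain ⟨q, hq, hqX, -⟩ := exists_isIndPath_of_walk p hp
    refine Or.inr ⟨q, hq, fun x hx => (hqX x hx).1, fun hx => ?_, ?_⟩
    · rcases (hqX u hx).2 with h | h
      · exact hcs h
      · exact hβu h.symm
    · have alt : ∀ n, n ≤ q.length → (Even n ↔ c (q.getVert n) = c s) := by
        intro n
        induction n with
        | zero => simp
        | succ n ih =>
          intro hn
          have ih' := ih (by omega)
          have hadj := q.adj_getVert_succ (i := n) (by omega)
          have h1 := hqX _ (q.getVert_mem_support n)
          have h2 := hqX _ (q.getVert_mem_support (n + 1))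
          have h3 := hc _ h1.1 _ h2.1 hadj
          rw [Nat.even_add_one, ih']
          constructor
          · intro h
            rcases h2.2 with h4 | h4
            · exact h4
            · rcases h1.2 with h5 | h5
              · exact absurd h5 h
              · exact absurd (h5.trans h4.symm) h3
          · intro h h'
            exact h3 (h'.trans h.symm)
      have := alt q.length le_rfl
      rw [Walk.getVert_length] at this
      rw [this, eq_comm]
  · left
    set R : Set V := {x | ∃ p : G.Walk s x, ∀ y ∈ p.support, y ∈ X} with hR
    have hRX : ∀ x ∈ R, x ∈ X := fun x ⟨p, hp⟩ => hp x p.end_mem_support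
    have hsR : s ∈ R := ⟨Walk.nil, by simp [hX, hs]⟩
    have hRadj : ∀ x ∈ R, ∀ y ∈ X, G.Adj x y → y ∈ R := by
      rintro x ⟨p, hp⟩ y hy hxy
      refine ⟨p.concat hxy, fun z hz => ?_⟩
      rw [Walk.support_concat, List.mem_append, List.mem_singleton] at hz
      rcases hz with hz | rfl
      · exact hp z hz
      · exact hy
    refine ⟨fun x => if x ∈ R then Equiv.swap (c s) β (c x) else c x, ?_, ?_⟩
    · have mixed : ∀ x ∈ R, ∀ y ∈ B, y ∉ R → G.Adj x y → Equiv.swap (c s) β (c x) ≠ c y := by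
        intro x hx y hy hyR hxy hcon
        have hyX : y ∉ X := fun h => hyR (hRadj x hx y h hxy)
        apply hyX
        refine ⟨hy, ?_⟩
        rcases (hRX x hx).2 with h | h
        · rw [h, Equiv.swap_apply_left] at hcon
          exact Or.inr hcon.symm
        · rw [h, Equiv.swap_apply_right] at hcon
          exact Or.inl hcon.symm
      intro x hx y hy hxy
      by_cases hxR : x ∈ R <;> by_cases hyR : y ∈ R
      · simp only [hxR, hyR, if_true]
        exact fun h => hc x hx y hy hxy ((Equiv.swap (c s) β).injective h)
      · simp only [hxR, hyR, if_true, if_false]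
        exact mixed x hxR y hy hyR hxy
      · simp only [hxR, hyR, if_true, if_false]
        exact (mixed y hyR x hx hxR hxy.symm).symm
      · simp only [hxR, hyR, if_false]
        exact hc x hx y hy hxy
    · have htR : t ∉ R := hw
      simp only [hsR, htR, if_true, if_false, Equiv.swap_apply_left]
      constructor
      · rintro h h'
        exact hβs (h.trans h'.symm)
      · intro h
        rcases hβt with h' | h'
        · exact absurd h'.symm h
        · exact h'.symm

theorem exists_perm_fin_three (a b a' b' : Fin 3) (h : a ≠ b) (h' : a' ≠ b') :
    ∃ σ : Equiv.Perm (Fin 3), σ a = a' ∧ σ b = b' := by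
  revert a b a' b'
  decide

theorem eq_of_ne_of_ne_fin_three {a b d e : Fin 3} (h1 : a ≠ b) (h2 : a ≠ d) (h3 : b ≠ d)
    (h4 : b ≠ e) (h5 : d ≠ e) : a = e := by
  revert a b d e
  decide

/-- A 4-vertex-critical graph in `𝒢_l` has no cutset contained in a path `s u t`. Each side of such
a cutset would have a 3-colouring, and all colourings of one side would give `s` and `t` the same
colour, those of the other side different ones. Kempe chains then provide induced paths from `s` to
`t` of different parity, one on each side, whose union is too long an odd hole. -/
theorem not_exists_cutset_path {l : ℕ} (hl : 2 ≤ l) (hG : InFamily l G)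
    (hcrit : IsVertexCritical 4 G) {s u t : V} (hus : G.Adj u s) (hut : G.Adj u t) (hst : s ≠ t)
    {K : Set V} (hsK : s ∉ K) (huK : u ∉ K) (htK : t ∉ K) (hne : K.Nonempty)
    (hK : ∀ x ∈ K, ∀ y, G.Adj x y → y ∈ K ∨ y = s ∨ y = u ∨ y = t)
    {w : V} (hwK : w ∉ K) (hws : w ≠ s) (hwu : w ≠ u) (hwt : w ≠ t) : False := by
  classical
  set A : Set V := {x | x ∈ K ∨ x = s ∨ x = u ∨ x = t} with hA
  have hsA : s ∈ A := Or.inr (Or.inl rfl)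
  have huA : u ∈ A := Or.inr (Or.inr (Or.inl rfl))
  have htA : t ∈ A := Or.inr (Or.inr (Or.inr rfl))
  -- colourings of the two sides that agree in whether `s` and `t` have equal colours can be glued
  have glue : ∀ c₁ c₂, ColorsOn G c₁ Kᶜ → ColorsOn G c₂ A → ¬ (c₁ s = c₁ t ↔ c₂ s = c₂ t) := by
    intro c₁ c₂ h₁ h₂ hiff
    have e1 := h₁ u huK s hsK hus
    have e2 := h₁ u huK t htK hut
    have e3 := h₂ u huA s hsA hus
    have e4 := h₂ u huA t htA hut
    obtain ⟨σ, hσu, hσs⟩ := exists_perm_fin_three _ _ _ _ e3 e1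
    have hσt : σ (c₂ t) = c₁ t := by
      by_cases h : c₂ s = c₂ t
      · rw [← h, hσs, hiff.2 h]
      · have f1 : σ (c₂ t) ≠ c₁ u := fun h' => e4 (σ.injective (hσu.trans h'.symm))
        have f2 : σ (c₂ t) ≠ c₁ s := fun h' => h (σ.injective (hσs.trans h'.symm))
        have f3 : c₁ s ≠ c₁ t := fun h' => h (hiff.1 h')
        exact eq_of_ne_of_ne_fin_three f1 f2 e1 e2 f3
    have mixed : ∀ x ∈ K, ∀ y, y ∉ K → G.Adj x y → σ (c₂ x) ≠ c₁ y := by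
      intro x hx y hy hxy
      have hyA : y ∈ A := hK x hx y hxy
      have hne := h₂ x (Or.inl hx) y hyA hxy
      have : σ (c₂ y) = c₁ y := by
        rcases hyA with h | rfl | rfl | rfl
        · exact absurd h hy
        · exact hσs
        · exact hσu
        · exact hσt
      rw [← this]
      exact fun h => hne (σ.injective h)
    refine hcrit.not_colorsOn_univ (fun x => if x ∈ K then σ (c₂ x) else c₁ x)
      fun x _ y _ hxy => ?_
    by_cases hx : x ∈ K <;> by_cases hy : y ∈ K
    · simp only [hx, hy, if_true]
      exact fun h => h₂ x (Or.inl hx) y (Or.inl hy) hxy (σ.injective h)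
    · simp only [hx, hy, if_true, if_false]
      exact mixed x hx y hy hxy
    · simp only [hx, hy, if_true, if_false]
      exact (mixed y hy x hx hxy.symm).symm
    · simp only [hx, hy, if_false]
      exact h₁ x hx y hy hxy
  obtain ⟨k, hk⟩ := hne
  obtain ⟨c₁, h₁⟩ := hcrit.exists_colorsOn k
  replace h₁ : ColorsOn G c₁ Kᶜ := h₁.mono fun x hx => by
    rintro rfl
    exact hx hk
  obtain ⟨c₂, h₂⟩ := hcrit.exists_colorsOn w
  replace h₂ : ColorsOn G c₂ A := h₂.mono fun x hx => by
    rintro rfl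
    rcases hx with h | h | h | h
    exacts [hwK h, hws h, hwu h, hwt h]
  have hno := glue c₁ c₂ h₁ h₂
  rcases h₁.kempe hsK htK huK hus hut with ⟨c', hc', hiff⟩ | ⟨q₁, hq₁, hB₁, hu₁, hp₁⟩
  · exact glue c' c₂ hc' h₂ (by tauto)
  rcases h₂.kempe hsA htA huA hus hut with ⟨c', hc', hiff⟩ | ⟨q₂, hq₂, hB₂, hu₂, hp₂⟩
  · exact glue c₁ c' h₁ hc' (by tauto)
  have hgirth : ((2 * l + 1 : ℕ) : ℕ∞) ≤ G.egirth := hG.1.ge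
  have hpath : (Walk.cons hus.symm (Walk.cons hut Walk.nil)).IsPath := by
    simp [Walk.cons_isPath_iff, hus.ne', hut.ne, hst]
  have hg₁ := le_length_add_length hgirth hpath q₁ (x := u) (by simp) hu₁
  have hg₂ := le_length_add_length hgirth hpath q₂ (x := u) (by simp) hu₂
  have nst : ¬ G.Adj s t := by
    intro hadj
    have := le_length_add_length hgirth hpath hadj.toWalk (x := u) (by simp)
      (by simp [hus.ne, hut.ne])
    simp at this
    omega
  simp only [Walk.length_cons, Walk.length_nil] at hg₁ hg₂
  have hhole := isHole_append_reverse hq₂ hq₁ hst nst (by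
    intro x hx hxs hxt
    have hxK : x ∈ K := by
      rcases hB₂ x hx with h | h | h | h
      exacts [h, absurd h hxs, absurd (h ▸ hx) hu₂, absurd h hxt]
    refine ⟨fun hx' => hB₁ x hx' hxK, fun y hy hxy => ?_⟩
    rcases hK x hxK y hxy with h | h | h | h
    exacts [absurd h (hB₁ y hy), Or.inl h, absurd (h ▸ hy) hu₁, Or.inr h])
  have hlen := hG.length_eq hhole (by
    rw [Walk.length_append, Walk.length_reverse, Nat.odd_add, ← Nat.not_even_iff_odd, hp₂, hp₁]
    tauto)
  rw [Walk.length_append, Walk.length_reverse] at hlen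
  omega

/-! ### Induced `K₄`-subdivisions with symmetric indexing -/

/-- An induced subdivision of `K₄` all of whose triangles have length `2l + 1`, indexed by `Fin 4`
so that the symmetry group of `K₄` acts by renaming the indices. `seg i j` is the subdivided edge
from `u i` to `u j`; both orientations are recorded, and `seg i i` is the trivial walk. -/
structure Frame (G : SimpleGraph V) (l : ℕ) where
  /-- the branch vertices -/
  u : Fin 4 → V
  /-- the subdivided edges -/
  seg : ∀ i j, G.Walk (u i) (u j)
  inj : Function.Injective u
  seg_symm : ∀ i j, seg j i = (seg i j).reverse
  isPath : ∀ i j, (seg i j).IsPath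
  meet : ∀ {i j k x}, i ≠ j → i ≠ k → j ≠ k → x ∈ (seg i j).support → x ∈ (seg i k).support →
    x = u i
  disj : ∀ {i j k m x}, i ≠ j → i ≠ k → i ≠ m → j ≠ k → j ≠ m → k ≠ m →
    x ∈ (seg i j).support → x ∉ (seg k m).support
  length_triangle : ∀ {i j k}, i ≠ j → i ≠ k → j ≠ k →
    (seg i j).length + (seg j k).length + (seg i k).length = 2 * l + 1
  induced : ∀ {i j k m x y}, i ≠ j → k ≠ m → x ∈ (seg i j).support → y ∈ (seg k m).support →
    G.Adj x y → ∃ e f, e ≠ f ∧ s(x, y) ∈ (seg e f).edges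

namespace Frame

variable {l : ℕ} (F : Frame G l)

/-- The length of a subdivided edge. -/
def len (i j : Fin 4) : ℕ := (F.seg i j).length

/-- The vertex `x` lies on `seg i j` at distance `a` from `u i` along it. -/
def At (i j : Fin 4) (a : ℕ) (x : V) : Prop := a ≤ F.len i j ∧ (F.seg i j).getVert a = x

/-- The vertex set of the subdivision. -/
def verts : Set V := {x | ∃ i j, i ≠ j ∧ x ∈ (F.seg i j).support}

theorem len_symm (i j : Fin 4) : F.len j i = F.len i j := by
  rw [len, F.seg_symm i j, Walk.length_reverse, len]

theorem len_triangle {i j k : Fin 4} (hij : i ≠ j) (hik : i ≠ k) (hjk : j ≠ k) :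
    F.len i j + F.len j k + F.len i k = 2 * l + 1 :=
  F.length_triangle hij hik hjk

theorem len_pos {i j : Fin 4} (hij : i ≠ j) : 0 < F.len i j := by
  rw [len, Nat.pos_iff_ne_zero]
  exact fun h => hij (F.inj (Walk.eq_of_length_eq_zero h))

variable {F}

theorem At.le {i j : Fin 4} {a : ℕ} {x : V} (h : F.At i j a x) : a ≤ F.len i j := h.1

theorem At.mem {i j : Fin 4} {a : ℕ} {x : V} (h : F.At i j a x) : x ∈ (F.seg i j).support :=
  h.2 ▸ Walk.getVert_mem_support _ _

theorem At.mem_verts {i j : Fin 4} {a : ℕ} {x : V} (h : F.At i j a x) (hij : i ≠ j) :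
    x ∈ F.verts :=
  ⟨i, j, hij, h.mem⟩

theorem exists_at {i j : Fin 4} {x : V} (h : x ∈ (F.seg i j).support) : ∃ a, F.At i j a x := by
  obtain ⟨a, h1, h2⟩ := Walk.mem_support_iff_exists_getVert.1 h
  exact ⟨a, h2, h1⟩

theorem mem_seg_symm {i j : Fin 4} {x : V} :
    x ∈ (F.seg j i).support ↔ x ∈ (F.seg i j).support := by
  rw [F.seg_symm i j, Walk.support_reverse, List.mem_reverse]

theorem At.symm {i j : Fin 4} {a : ℕ} {x : V} (h : F.At i j a x) :
    F.At j i (F.len i j - a) x := by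
  have h1 := h.1
  refine ⟨by rw [F.len_symm]; omega, ?_⟩
  rw [F.seg_symm i j, Walk.getVert_reverse]
  have : (F.seg i j).length - (F.len i j - a) = a := by
    change F.len i j - (F.len i j - a) = a
    omega
  rw [this, h.2]

theorem At.unique {i j : Fin 4} {a b : ℕ} {x : V} (h : F.At i j a x) (h' : F.At i j b x) :
    a = b :=
  (F.isPath i j).getVert_injOn h.1 h'.1 (h.2.trans h'.2.symm)

theorem At.eq {i j : Fin 4} {a : ℕ} {x y : V} (h : F.At i j a x) (h' : F.At i j a y) : x = y :=
  h.2.symm.trans h'.2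

theorem at_left (i j : Fin 4) : F.At i j 0 (F.u i) := ⟨Nat.zero_le _, Walk.getVert_zero _⟩

theorem at_right (i j : Fin 4) : F.At i j (F.len i j) (F.u j) := ⟨le_rfl, Walk.getVert_length _⟩

theorem At.left_iff {i j : Fin 4} {a : ℕ} (h : F.At i j a (F.u i)) : a = 0 := h.unique (at_left i j)

theorem At.right_iff {i j : Fin 4} {a : ℕ} (h : F.At i j a (F.u j)) : a = F.len i j :=
  h.unique (at_right i j)

theorem u_mem_verts (i : Fin 4) : F.u i ∈ F.verts := by
  obtain ⟨j, hj⟩ : ∃ j, i ≠ j := by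
    revert i
    decide
  exact ⟨i, j, hj, Walk.start_mem_support _⟩

/-- Two different subdivided edges meet only in common branch vertices. -/
theorem common {i j k m : Fin 4} (hij : i ≠ j) (hkm : k ≠ m) {x : V}
    (h : x ∈ (F.seg i j).support) (h' : x ∈ (F.seg k m).support) :
    (i = k ∧ j = m) ∨ (i = m ∧ j = k) ∨
      ∃ n, x = F.u n ∧ (n = i ∨ n = j) ∧ (n = k ∨ n = m) := by
  by_cases h1 : i = k
  · subst h1
    by_cases h2 : j = m
    · exact Or.inl ⟨rfl, h2⟩
    · exact Or.inr (Or.inr ⟨i, F.meet hij hkm h2 h h', by simp⟩)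
  by_cases h2 : i = m
  · subst h2
    by_cases h3 : j = k
    · exact Or.inr (Or.inl ⟨rfl, h3⟩)
    · exact Or.inr (Or.inr ⟨i, F.meet hij h1 h3 h (mem_seg_symm.1 h'), by simp⟩)
  by_cases h3 : j = k
  · subst h3
    exact Or.inr (Or.inr ⟨j, F.meet (Ne.symm hij) hkm h2 (mem_seg_symm.1 h) h', by simp⟩)
  by_cases h4 : j = m
  · subst h4
    exact Or.inr (Or.inr ⟨j, F.meet (Ne.symm hij) h3 h1 (mem_seg_symm.1 h) (mem_seg_symm.1 h'),
      by simp⟩)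
  · exact absurd h' (F.disj hij h1 h2 h3 h4 hkm h)

theorem u_mem_seg {i j n : Fin 4} (hij : i ≠ j) (h : F.u n ∈ (F.seg i j).support) :
    n = i ∨ n = j := by
  by_contra! hn
  have := F.meet (Ne.symm hn.1) hij hn.2 (Walk.end_mem_support _) h
  exact hn.1 (F.inj this)

/-- Adjacent vertices of the subdivision are consecutive on a subdivided edge. -/
theorem exists_at_of_adj {x y : V} (hx : x ∈ F.verts) (hy : y ∈ F.verts) (hxy : G.Adj x y) :
    ∃ e f n, e ≠ f ∧ F.At e f n x ∧ F.At e f (n + 1) y := by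
  obtain ⟨i, j, hij, hx⟩ := hx
  obtain ⟨k, m, hkm, hy⟩ := hy
  obtain ⟨e, f, hef, he⟩ := F.induced hij hkm hx hy hxy
  obtain ⟨n, hn, h⟩ := (F.seg e f).mk_mem_edges_iff_exists.1 he
  rcases Sym2.eq_iff.1 h with ⟨h1, h2⟩ | ⟨h1, h2⟩
  · exact ⟨e, f, n, hef, ⟨hn.le, h1⟩, ⟨hn, h2⟩⟩
  · have a1 : F.At e f (n + 1) x := ⟨hn, h2⟩
    have a2 : F.At e f n y := ⟨hn.le, h1⟩
    refine ⟨f, e, _, hef.symm, a1.symm, ?_⟩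
    have h3 := a2.symm
    have h4 := a1.le
    have : F.len e f - (n + 1) + 1 = F.len e f - n := by omega
    rwa [this]

theorem adj_of_at {i j : Fin 4} {a : ℕ} {x y : V} (hx : F.At i j a x) (hy : F.At i j (a + 1) y) :
    G.Adj x y := by
  rw [← hx.2, ← hy.2]
  exact Walk.adj_getVert_succ _ hy.1

/-- Adjacent vertices on one subdivided edge are consecutive there. -/
theorem eq_succ_of_adj {i j : Fin 4} (hij : i ≠ j) {a b : ℕ} {x y : V} (hx : F.At i j a x)
    (hy : F.At i j b y) (hxy : G.Adj x y) : b = a + 1 ∨ a = b + 1 := by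
  obtain ⟨e, f, n, hef, h1, h2⟩ := exists_at_of_adj (hx.mem_verts hij) (hy.mem_verts hij) hxy
  have aux : ∀ {z n'}, (e = i ∧ f = j) → F.At e f n' z → F.At i j n' z := by
    rintro z n' ⟨rfl, rfl⟩ h
    exact h
  have aux' : ∀ {z n'}, (e = j ∧ f = i) → F.At e f n' z → F.At i j (F.len i j - n') z := by
    rintro z n' ⟨rfl, rfl⟩ h
    rw [← F.len_symm]
    exact h.symm
  have same : (e = i ∧ f = j) ∨ (e = j ∧ f = i) → b = a + 1 ∨ a = b + 1 := by
    rintro (h | h)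
    · have e1 := hx.unique (aux h h1)
      have e2 := hy.unique (aux h h2)
      omega
    · have e1 := hx.unique (aux' h h1)
      have e2 := hy.unique (aux' h h2)
      have e3 := h2.le
      rw [h.1, h.2, F.len_symm] at e3
      omega
  rcases common hef hij h1.mem hx.mem with h | h | ⟨p, rfl, hp⟩
  · exact same (Or.inl h)
  · exact same (Or.inr h)
  rcases common hef hij h2.mem hy.mem with h | h | ⟨q, rfl, hq⟩
  · exact same (Or.inl h)
  · exact same (Or.inr h)
  have hpq : p ≠ q := fun h => hxy.ne (by rw [h])
  apply same
  grind

/-- Adjacent branch vertices are joined by a subdivided edge of length one. -/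
theorem len_eq_one_of_adj {i j : Fin 4} (hij : i ≠ j) (h : G.Adj (F.u i) (F.u j)) :
    F.len i j = 1 := by
  have := eq_succ_of_adj hij (at_left i j) (at_right i j) h
  omega

theorem isIndPath_seg {i j : Fin 4} (hij : i ≠ j) : IsIndPath (F.seg i j) := by
  refine ⟨F.isPath i j, Walk.isChordless_iff_forall_mem_edges.2 fun x y hx hy hxy => ?_⟩
  obtain ⟨a, ha⟩ := exists_at hx
  obtain ⟨b, hb⟩ := exists_at hy
  rw [Walk.mk_mem_edges_iff_exists]
  have e1 := ha.le
  have e2 := hb.le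
  rw [len] at e1 e2
  rcases eq_succ_of_adj hij ha hb hxy with rfl | rfl
  · exact ⟨a, by omega, by rw [ha.2, hb.2]⟩
  · exact ⟨b, by omega, by rw [ha.2, hb.2, Sym2.eq_swap]⟩

/-- The part of a subdivided edge between one of its vertices and the first end. -/
theorem exists_walk_left {i j : Fin 4} (hij : i ≠ j) {a : ℕ} {x : V} (h : F.At i j a x) :
    ∃ W : G.Walk x (F.u i), IsIndPath W ∧ W.length = a ∧
      ∀ v ∈ W.support, ∃ b ≤ a, F.At i j b v := by
  obtain ⟨hle, rfl⟩ := h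
  have hind : IsIndPath ((F.seg i j).take a) := by
    have := isIndPath_seg (F := F) hij
    rw [← (F.seg i j).append_take_drop_eq a] at this
    exact this.of_append_left
  have hlen : ((F.seg i j).take a).length = a := by
    rw [Walk.take_length]
    exact min_eq_left hle
  refine ⟨((F.seg i j).take a).reverse, hind.reverse, by rw [Walk.length_reverse, hlen], ?_⟩
  intro v hv
  rw [Walk.support_reverse, List.mem_reverse] at hv
  obtain ⟨n, rfl, hn⟩ := Walk.mem_support_iff_exists_getVert.1 hv
  rw [hlen] at hn
  refine ⟨n, hn, hn.trans hle, ?_⟩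
  rw [Walk.take_getVert, min_eq_right hn]

end Frame

namespace Frame

variable {l : ℕ} {F : Frame G l}

/-! ### Induced paths inside the subdivision -/

/-- `W` is an induced path that starts on `seg i x` at distance `a` from `u i`, follows `seg i x`
to `u i`, and then runs to `u b` along the subdivided edges listed by `P`. -/
structure Route (F : Frame G l) (i x : Fin 4) (a : ℕ) (P : Fin 4 → Fin 4 → Prop) {s : V}
    {b : Fin 4} (W : G.Walk s (F.u b)) : Prop where
  ind : IsIndPath W
  cover : ∀ v ∈ W.support, (∃ a' ≤ a, F.At i x a' v) ∨
    ∃ n n', n ≠ n' ∧ P n n' ∧ v ∈ (F.seg n n').support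

theorem exists_route_start {i x : Fin 4} (hix : i ≠ x) {a : ℕ} {s : V} (hs : F.At i x a s) :
    ∃ W : G.Walk s (F.u i), F.Route i x a (fun _ _ => False) W ∧ W.length = a := by
  obtain ⟨W, h1, h2, h3⟩ := exists_walk_left hix hs
  exact ⟨W, ⟨h1, fun v hv => Or.inl (h3 v hv)⟩, h2⟩

/-- A common vertex of two subdivided edges, away from one end of the first, is the other end. -/
theorem eq_u_of_mem {i j k m : Fin 4} (hij : i ≠ j) (hkm : k ≠ m) {x : V}
    (h : x ∈ (F.seg i j).support) (h' : x ∈ (F.seg k m).support)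
    (hne : ¬ ((i = k ∧ j = m) ∨ (i = m ∧ j = k))) (hx : x ≠ F.u i) :
    x = F.u j ∧ (j = k ∨ j = m) := by
  rcases common hij hkm h h' with h1 | h1 | ⟨n, rfl, rfl | rfl, hn⟩
  · exact absurd (Or.inl h1) hne
  · exact absurd (Or.inr h1) hne
  · exact absurd rfl hx
  · exact ⟨rfl, hn⟩

/-- Contact between a subdivided edge `seg k m` and the part of another subdivided edge `seg b c`
after `u b`: it is at `u b`, or an adjacency of `u c` with a neighbour on a third one. -/
theorem contact {k m b c : Fin 4} (hkm : k ≠ m) (hbc : b ≠ c)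
    (hne : ¬ ((b = k ∧ c = m) ∨ (b = m ∧ c = k))) {v y : V} (hv : v ∈ (F.seg k m).support)
    (hy : y ∈ (F.seg b c).support) (hyb : y ≠ F.u b) (hvy : G.Adj v y) :
    v = F.u b ∨ (y = F.u c ∧ ((c = k ∨ c = m) ∨
      ∃ n, n ≠ c ∧ v = F.u n ∧ (n = k ∨ n = m) ∧ F.len n c = 1)) ∨
      (v = F.u c ∧ (c = k ∨ c = m)) := by
  obtain ⟨e, f, n, hef, h1, h2⟩ := exists_at_of_adj ⟨k, m, hkm, hv⟩ ⟨b, c, hbc, hy⟩ hvy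
  by_cases hsame : (b = e ∧ c = f) ∨ (b = f ∧ c = e)
  · have hvbc : v ∈ (F.seg b c).support := by
      rcases hsame with ⟨rfl, rfl⟩ | ⟨rfl, rfl⟩
      · exact h1.mem
      · exact mem_seg_symm.1 h1.mem
    by_cases hvb : v = F.u b
    · exact Or.inl hvb
    · exact Or.inr (Or.inr (eq_u_of_mem hbc hkm hvbc hv hne hvb))
  · obtain ⟨rfl, hc⟩ := eq_u_of_mem hbc hef hy h2.mem hsame hyb
    refine Or.inr (Or.inl ⟨rfl, ?_⟩)
    by_cases hckm : c = k ∨ c = m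
    · exact Or.inl hckm
    refine Or.inr ?_
    have hne2 : ¬ ((k = e ∧ m = f) ∨ (k = f ∧ m = e)) := by
      rintro (⟨rfl, rfl⟩ | ⟨rfl, rfl⟩)
      · exact hckm hc
      · exact hckm hc.symm
    rcases common hkm hef hv h1.mem with h | h | ⟨p, rfl, hp, hp'⟩
    · exact absurd (Or.inl h) hne2
    · exact absurd (Or.inr h) hne2
    · have hpc : p ≠ c := fun h => hvy.ne (by rw [h])
      exact ⟨p, hpc, rfl, hp, len_eq_one_of_adj hpc hvy⟩

/-- Continuing a route along `seg b c`. The inequalities make sure that the new end `u c` has no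
neighbour on the route besides the one on `seg b c`. -/
theorem Route.step {i x b c : Fin 4} {a : ℕ} {P : Fin 4 → Fin 4 → Prop} {s : V}
    {W : G.Walk s (F.u b)} (hW : F.Route i x a P W) (hix : i ≠ x) (ha : a < F.len i x)
    (hbc : b ≠ c) (hci : c ≠ i) (hxc : c = x → a + 2 ≤ F.len i x ∧ b ≠ i)
    (hic : i ≠ b → 2 ≤ F.len i c)
    (hP : ∀ n n', P n n' → c ≠ n ∧ c ≠ n' ∧ (n ≠ b → 2 ≤ F.len n c) ∧
      (n' ≠ b → 2 ≤ F.len n' c)) :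
    F.Route i x a (fun n n' => P n n' ∨ (n = b ∧ n' = c)) (W.append (F.seg b c)) := by
  refine ⟨hW.ind.append (isIndPath_seg hbc) fun v hv y hy hyb => ?_, fun v hv => ?_⟩
  · rcases hW.cover v hv with ⟨a', ha', hv'⟩ | ⟨n, n', hnn, hPn, hv'⟩
    · have hne : ¬ ((b = i ∧ c = x) ∨ (b = x ∧ c = i)) := by
        rintro (⟨h1, h2⟩ | ⟨h1, h2⟩)
        · exact (hxc h2).2 h1
        · exact hci h2
      have hvx : v ≠ F.u x := by
        rintro rfl
        have := hv'.right_iff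
        omega
      constructor
      · rintro rfl
        obtain ⟨rfl, h | h⟩ := eq_u_of_mem hbc hix hy hv'.mem hne hyb
        · exact hci h
        · exact hvx (by rw [h])
      · intro hadj
        rcases contact hix hbc hne hv'.mem hy hyb hadj with h | ⟨rfl, h | ⟨n, hnc, rfl, h, h1⟩⟩ |
          ⟨rfl, h⟩
        · exact h
        · have hcx : c = x := h.resolve_left hci
          subst hcx
          have := eq_succ_of_adj hix hv' (at_right i c) hadj
          have := (hxc rfl).1
          omega
        · rcases h with rfl | rfl
          · by_contra hnb
            have := hic fun h => hnb (by rw [h])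
            omega
          · exact absurd rfl hvx
        · rcases h with h | h
          · exact absurd h hci
          · exact absurd (by rw [h]) hvx
    · obtain ⟨hcn, hcn', hl, hl'⟩ := hP n n' hPn
      have hne : ¬ ((b = n ∧ c = n') ∨ (b = n' ∧ c = n)) := by tauto
      constructor
      · rintro rfl
        obtain ⟨rfl, h | h⟩ := eq_u_of_mem hbc hnn hy hv' hne hyb
        · exact hcn h
        · exact hcn' h
      · intro hadj
        rcases contact hnn hbc hne hv' hy hyb hadj with h | ⟨rfl, h | ⟨q, hqc, rfl, h, h1⟩⟩ |
          ⟨rfl, h⟩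
        · exact h
        · tauto
        · by_contra hqb
          have hqb' : q ≠ b := fun h => hqb (by rw [h])
          rcases h with rfl | rfl
          · have := hl hqb'
            omega
          · have := hl' hqb'
            omega
        · tauto
  · rw [Walk.mem_support_append_iff] at hv
    rcases hv with hv | hv
    · rcases hW.cover v hv with h | ⟨n, n', hnn, hPn, hv'⟩
      · exact Or.inl h
      · exact Or.inr ⟨n, n', hnn, Or.inl hPn, hv'⟩
    · exact Or.inr ⟨b, c, hbc, Or.inr ⟨rfl, rfl⟩, hv⟩

/-- Completing a route by the initial part of a further subdivided edge `seg b y`. -/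
theorem Route.finish {i x b y : Fin 4} {a c : ℕ} {P : Fin 4 → Fin 4 → Prop} {s t : V}
    {W : G.Walk s (F.u b)} (hW : F.Route i x a P W) (hix : i ≠ x) (ha : a < F.len i x)
    (hby : b ≠ y) (hc : c < F.len b y) (ht : F.At b y c t)
    (hsame : ¬ (i = b ∧ x = y)) (hopp : i = y → x = b → a + c + 2 ≤ F.len i x)
    (hiy : i = y → c + 2 ≤ F.len b y)
    (hP : ∀ n n', P n n' → ¬ ((b = n ∧ y = n') ∨ (b = n' ∧ y = n)) ∧
      (n = y ∨ n' = y → c + 2 ≤ F.len b y)) :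
    ∃ W' : G.Walk s t, IsIndPath W' ∧ W'.length = W.length + c ∧
      ∀ v ∈ W'.support, (∃ a' ≤ a, F.At i x a' v) ∨
        (∃ n n', n ≠ n' ∧ P n n' ∧ v ∈ (F.seg n n').support) ∨ ∃ c' ≤ c, F.At b y c' v := by
  obtain ⟨B, hB, hBlen, hBc⟩ := exists_walk_left hby ht
  refine ⟨W.append B.reverse, hW.ind.append hB.reverse fun v hv w hw hwb => ?_,
    by rw [Walk.length_append, Walk.length_reverse, hBlen], fun v hv => ?_⟩
  · rw [Walk.support_reverse, List.mem_reverse] at hw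
    obtain ⟨c', hc', hw'⟩ := hBc w hw
    have hwy : w ≠ F.u y := by
      rintro rfl
      have := hw'.right_iff
      omega
    have main : ∀ k m, k ≠ m → v ∈ (F.seg k m).support →
        ¬ ((b = k ∧ y = m) ∨ (b = m ∧ y = k)) → (v = F.u y → c + 2 ≤ F.len b y) →
        v ≠ w ∧ (G.Adj v w → v = F.u b) := by
      intro k m hkm hvkm hne hlen
      constructor
      · rintro rfl
        exact hwy (eq_u_of_mem hby hkm hw'.mem hvkm hne hwb).1
      · intro hadj
        rcases contact hkm hby hne hvkm hw'.mem hwb hadj with h | ⟨rfl, -⟩ | ⟨rfl, h⟩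
        · exact h
        · exact absurd rfl hwy
        · have h1 := hlen rfl
          have := eq_succ_of_adj hby hw' (at_right b y) hadj.symm
          omega
    rcases hW.cover v hv with ⟨a', ha', hv'⟩ | ⟨n, n', hnn, hPn, hv'⟩
    · have hvx : v ≠ F.u x := by
        rintro rfl
        have := hv'.right_iff
        omega
      by_cases hrev : i = y ∧ x = b
      · obtain ⟨rfl, rfl⟩ := hrev
        have h1 := hopp rfl rfl
        have h2 := hw'.symm
        have h3 := hw'.le
        have h4 := F.len_symm i x
        constructor
        · rintro rfl
          have := hv'.unique h2
          omega
        · intro hadj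
          have := eq_succ_of_adj hix hv' h2 hadj
          omega
      · refine main i x hix hv'.mem ?_ ?_
        · rintro (⟨rfl, rfl⟩ | ⟨rfl, rfl⟩)
          · exact hsame ⟨rfl, rfl⟩
          · exact hrev ⟨rfl, rfl⟩
        · rintro rfl
          rcases u_mem_seg hix hv'.mem with h | h
          · exact hiy h.symm
          · exact absurd (by rw [h]) hvx
    · refine main n n' hnn hv' (hP n n' hPn).1 ?_
      rintro rfl
      exact (hP n n' hPn).2 ((u_mem_seg hnn hv').imp Eq.symm Eq.symm)
  · rw [Walk.mem_support_append_iff, Walk.support_reverse, List.mem_reverse] at hv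
    rcases hv with hv | hv
    · rcases hW.cover v hv with h | h
      · exact Or.inl h
      · exact Or.inr (Or.inl h)
    · exact Or.inr (Or.inr (hBc v hv))

end Frame

namespace Frame

variable {l : ℕ} {F : Frame G l}

/-! ### Jumps over the subdivision -/

/-- The possible relative positions of two vertices of the subdivision. -/
theorem exists_at_at {x y : V} (hx : x ∈ F.verts) (hy : y ∈ F.verts) :
    (∃ i j a c, i ≠ j ∧ F.At i j a x ∧ F.At i j c y) ∨
      (∃ i j k a c, i ≠ j ∧ i ≠ k ∧ j ≠ k ∧ F.At i j a x ∧ F.At i k c y) ∨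
      ∃ i j k m a c, i ≠ j ∧ i ≠ k ∧ i ≠ m ∧ j ≠ k ∧ j ≠ m ∧ k ≠ m ∧ F.At i j a x ∧
        F.At k m c y := by
  obtain ⟨i, j, hij, hx⟩ := hx
  obtain ⟨k, m, hkm, hy⟩ := hy
  obtain ⟨a, ha⟩ := exists_at hx
  obtain ⟨c, hc⟩ := exists_at hy
  by_cases h1 : i = k
  · subst h1
    by_cases h2 : j = m
    · subst h2
      exact Or.inl ⟨i, j, a, c, hij, ha, hc⟩
    · exact Or.inr (Or.inl ⟨i, j, m, a, c, hij, hkm, h2, ha, hc⟩)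
  by_cases h2 : i = m
  · subst h2
    by_cases h3 : j = k
    · subst h3
      exact Or.inl ⟨i, j, a, _, hij, ha, hc.symm⟩
    · exact Or.inr (Or.inl ⟨i, j, k, a, _, hij, h1, h3, ha, hc.symm⟩)
  by_cases h3 : j = k
  · subst h3
    exact Or.inr (Or.inl ⟨j, i, m, _, c, hij.symm, hkm, h2, ha.symm, hc⟩)
  by_cases h4 : j = m
  · subst h4
    exact Or.inr (Or.inl ⟨j, i, k, _, _, hij.symm, h3, h1, ha.symm, hc.symm⟩)
  · exact Or.inr (Or.inr ⟨i, j, k, m, a, c, hij, h1, h2, h3, h4, hkm, ha, hc⟩)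

theorem len_self (i : Fin 4) : F.len i i = 0 :=
  Walk.length_eq_zero_iff.2 (Walk.isPath_iff_nil.1 (F.isPath i i))

theorem exists_walk_between {i j k m : Fin 4} (hij : i ≠ j) (hkm : k ≠ m) {a c : ℕ} {x y : V}
    (hx : F.At i j a x) (hy : F.At k m c y) :
    ∃ W : G.Walk x y, W.length = a + F.len i k + c ∧ ∀ v ∈ W.support, v ∈ F.verts := by
  obtain ⟨A, -, hA, hAv⟩ := exists_walk_left hij hx
  obtain ⟨B, -, hB, hBv⟩ := exists_walk_left hkm hy
  refine ⟨(A.append (F.seg i k)).append B.reverse, ?_, fun v hv => ?_⟩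
  · simp only [Walk.length_append, Walk.length_reverse, hA, hB, len]
  · simp only [Walk.mem_support_append_iff, Walk.support_reverse, List.mem_reverse] at hv
    rcases hv with (hv | hv) | hv
    · obtain ⟨b, -, hb⟩ := hAv v hv
      exact hb.mem_verts hij
    · by_cases hik : i = k
      · subst hik
        obtain ⟨b, hb⟩ := exists_at hv
        have h1 := hb.le
        rw [len_self] at h1
        obtain rfl : b = 0 := by omega
        rw [hb.eq (at_left i i)]
        exact u_mem_verts i
      · exact ⟨i, k, hik, hv⟩
    · obtain ⟨b, -, hb⟩ := hBv v hv
      exact hb.mem_verts hkm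

/-- The two paths from `u i` to `u j` through one further branch vertex each form a cycle of length
`2 * (2l + 1) - 2 * len i j`, which is at least the girth. -/
theorem len_le (hG : InFamily l G) {i j : Fin 4} (hij : i ≠ j) : F.len i j ≤ l := by
  obtain ⟨k, m, hik, him, hjk, hjm, hkm⟩ :
      ∃ k m : Fin 4, i ≠ k ∧ i ≠ m ∧ j ≠ k ∧ j ≠ m ∧ k ≠ m := by
    revert i j
    decide
  have hpath : ((F.seg i k).append (F.seg k j)).IsPath := by
    refine isPath_append (F.isPath _ _) (F.isPath _ _) fun x hx hx' => ?_
    exact F.meet (Ne.symm hik) (Ne.symm hjk) hij (mem_seg_symm.1 hx) hx'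
  have h := le_length_add_length hG.1.ge hpath ((F.seg i m).append (F.seg m j)) (x := F.u k)
    (by simp) (by
      rw [Walk.mem_support_append_iff]
      rintro (h | h)
      · rcases u_mem_seg him h with h | h
        exacts [hik h.symm, hkm h]
      · rcases u_mem_seg (Ne.symm hjm) h with h | h
        exacts [hkm h, hjk h.symm])
  simp only [Walk.length_append] at h
  change 2 * l + 1 ≤ F.len i k + F.len k j + (F.len i m + F.len m j) at h
  have e1 := F.len_triangle hij hik hjk
  have e2 := F.len_triangle hij him hjm
  rw [F.len_symm j k, F.len_symm j m] at h
  omega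

/-- Opposite subdivided edges have equal lengths, and the lengths of three subdivided edges at a
branch vertex sum to `2l + 1`. -/
theorem len_eqs {i j k m : Fin 4} (hij : i ≠ j) (hik : i ≠ k) (him : i ≠ m) (hjk : j ≠ k)
    (hjm : j ≠ m) (hkm : k ≠ m) :
    F.len k m = F.len i j ∧ F.len j m = F.len i k ∧ F.len j k = F.len i m ∧
      F.len i j + F.len i k + F.len i m = 2 * l + 1 := by
  have e1 := F.len_triangle hij hik hjk
  have e2 := F.len_triangle hij him hjm
  have e3 := F.len_triangle hik him hkm
  have e4 := F.len_triangle hjk hjm hkm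
  omega

/-- No vertex outside the subdivision has two neighbours `x` and `y` in it: each path of the
subdivision from `x` to `y` would have length at least `2l - 1`, but one of them is shorter. -/
theorem eq_of_adj_of_adj (hl : 4 ≤ l) (hG : InFamily l G) {v x y : V} (hv : v ∉ F.verts)
    (hx : x ∈ F.verts) (hy : y ∈ F.verts) (hvx : G.Adj v x) (hvy : G.Adj v y) : x = y := by
  by_contra hxy
  have hpath : (Walk.cons hvx.symm (Walk.cons hvy Walk.nil)).IsPath := by
    simp [Walk.cons_isPath_iff, hvx.ne', hvy.ne, hxy]
  have key : ∀ i j k m a c, i ≠ j → k ≠ m → F.At i j a x → F.At k m c y →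
      2 * l + 1 ≤ 2 + (a + F.len i k + c) := by
    intro i j k m a c hij hkm h1 h2
    obtain ⟨W, hW, hWv⟩ := exists_walk_between hij hkm h1 h2
    have := le_length_add_length hG.1.ge hpath W (x := v) (by simp) fun h => hv (hWv v h)
    rw [hW] at this
    simpa using this
  rcases exists_at_at hx hy with ⟨i, j, a, c, hij, h1, h2⟩ |
    ⟨i, j, k, a, c, hij, hik, hjk, h1, h2⟩ |
    ⟨i, j, k, m, a, c, hij, hik, him, hjk, hjm, hkm, h1, h2⟩
  · have k1 := key i j i j a c hij hij h1 h2
    have k2 := key j i j i _ _ hij.symm hij.symm h1.symm h2.symm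
    rw [len_self] at k1 k2
    have := len_le (F := F) hG hij
    have := h1.le
    have := h2.le
    omega
  · have k1 := key i j i k a c hij hik h1 h2
    have k2 := key j i k i _ _ hij.symm hik.symm h1.symm h2.symm
    rw [len_self] at k1
    have := F.len_triangle hij hik hjk
    have := h1.le
    have := h2.le
    omega
  · have k1 := key i j k m a c hij hkm h1 h2
    have k2 := key j i k m _ c hij.symm hkm h1.symm h2
    have k3 := key i j m k a _ hij hkm.symm h1 h2.symm
    have k4 := key j i m k _ _ hij.symm hkm.symm h1.symm h2.symm
    have := len_le (F := F) hG hij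
    obtain ⟨e1, e2, e3, e4⟩ := F.len_eqs hij hik him hjk hjm hkm
    have := h1.le
    have := h2.le
    omega

/-- A jump over the subdivision: an induced path `R` of `G` between nonadjacent vertices of the
subdivision whose inner vertices lie outside and have no neighbours in the subdivision except the
ends of `R` and vertices of the exceptional set `Z`. The jump is called clean if `Z` is empty. -/
structure Jump (F : Frame G l) (Z : Set V) {s t : V} (R : G.Walk s t) : Prop where
  ind : IsIndPath R
  left_mem : s ∈ F.verts
  right_mem : t ∈ F.verts
  ne : s ≠ t
  not_adj : ¬ G.Adj s t
  off : ∀ x ∈ R.support, x ≠ s → x ≠ t → x ∉ F.verts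
  nbr : ∀ x ∈ R.support, x ≠ s → x ≠ t → ∀ y ∈ F.verts, G.Adj x y → y = s ∨ y = t ∨ y ∈ Z

theorem Jump.symm {Z : Set V} {s t : V} {R : G.Walk s t} (hR : F.Jump Z R) :
    F.Jump Z R.reverse where
  ind := hR.ind.reverse
  left_mem := hR.right_mem
  right_mem := hR.left_mem
  ne := hR.ne.symm
  not_adj h := hR.not_adj h.symm
  off x hx h1 h2 := hR.off x (by simpa using hx) h2 h1
  nbr x hx h1 h2 y hy hxy := by
    rcases hR.nbr x (by simpa using hx) h2 h1 y hy hxy with h | h | h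
    exacts [Or.inr (Or.inl h), Or.inl h, Or.inr (Or.inr h)]

theorem Jump.two_le {Z : Set V} {s t : V} {R : G.Walk s t} (hR : F.Jump Z R) : 2 ≤ R.length := by
  have h1 := hR.ne
  have h2 := hR.not_adj
  cases R with
  | nil => exact absurd rfl h1
  | cons h R => cases R with
    | nil => exact absurd h h2
    | cons h' R => simp

/-- A jump and a walk of the subdivision with the same ends contain a cycle. -/
theorem Jump.le_length {Z : Set V} {s t : V} {R : G.Walk s t} (hG : InFamily l G)
    (hR : F.Jump Z R) (W : G.Walk s t) (hW : ∀ v ∈ W.support, v ∈ F.verts) :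
    2 * l + 1 ≤ R.length + W.length := by
  have h2 := hR.two_le
  have hadj : G.Adj s (R.getVert 1) := by
    simpa using R.adj_getVert_succ (i := 0) (by omega)
  refine le_length_add_length hG.1.ge hR.ind.1 W (R.getVert_mem_support 1) fun h => ?_
  exact hR.off _ (R.getVert_mem_support 1) hadj.ne' (fun h' => hR.not_adj (h' ▸ hadj)) (hW _ h)

theorem Jump.le_length_of_at {Z : Set V} {s t : V} {R : G.Walk s t} (hG : InFamily l G)
    (hR : F.Jump Z R) {i j k m : Fin 4} (hij : i ≠ j) (hkm : k ≠ m) {a c : ℕ}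
    (hs : F.At i j a s) (ht : F.At k m c t) : 2 * l + 1 ≤ R.length + (a + F.len i k + c) := by
  obtain ⟨W, hW, hWv⟩ := exists_walk_between hij hkm hs ht
  exact hW ▸ hR.le_length hG W hWv

/-- A jump and an induced path of the subdivision that avoids `Z` form a hole. -/
theorem Jump.length_eq {Z : Set V} {s t : V} {R : G.Walk s t} (hG : InFamily l G)
    (hR : F.Jump Z R) {W : G.Walk s t} (hW : IsIndPath W)
    (hWv : ∀ v ∈ W.support, v ∈ F.verts ∧ v ∉ Z) (hodd : Odd (R.length + W.length)) :
    R.length + W.length = 2 * l + 1 := by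
  have hhole := isHole_append_reverse hR.ind hW hR.ne hR.not_adj (by
    intro x hx hxs hxt
    refine ⟨fun h => hR.off x hx hxs hxt (hWv x h).1, fun y hy hxy => ?_⟩
    rcases hR.nbr x hx hxs hxt y (hWv y hy).1 hxy with h | h | h
    exacts [Or.inl h, Or.inr h, absurd h (hWv y hy).2])
  have := hG.length_eq hhole (by rwa [Walk.length_append, Walk.length_reverse])
  rwa [Walk.length_append, Walk.length_reverse] at this

/-! The next four lemmas close a jump from `seg i x` to `seg j y` by a path through one, two, three
or four branch vertices, the first one being `u i` and the last one `u j`. The inequalities between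
lengths exclude chords of that path. -/

theorem Jump.odd_one {s t : V} {R : G.Walk s t} (hG : InFamily l G)
    (hR : F.Jump ∅ R) {i x y : Fin 4} (hix : i ≠ x) (hiy : i ≠ y) (hxy : x ≠ y) {a c : ℕ}
    (hs : F.At i x a s) (ha : a < F.len i x) (ht : F.At i y c t) (hc : c < F.len i y)
    (hodd : Odd (R.length + (a + c))) : R.length + (a + c) = 2 * l + 1 := by
  obtain ⟨W, hW, hlen⟩ := exists_route_start hix hs
  obtain ⟨W', h1, h2, h3⟩ := hW.finish hix ha hiy hc ht (by tauto) (by tauto) (by tauto) (by tauto)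
  rw [hlen] at h2
  rw [← h2] at hodd ⊢
  refine hR.length_eq hG h1 (fun v hv => ⟨?_, by simp⟩) hodd
  rcases h3 v hv with ⟨b, -, hb⟩ | ⟨n, n', hnn, -, hn⟩ | ⟨b, -, hb⟩
  exacts [hb.mem_verts hix, ⟨n, n', hnn, hn⟩, hb.mem_verts hiy]

theorem Jump.odd_two {Z : Set V} {s t : V} {R : G.Walk s t} (hG : InFamily l G)
    (hR : F.Jump Z R) {i j x y : Fin 4} (hij : i ≠ j) (hix : i ≠ x) (hjx : j ≠ x) (hjy : j ≠ y)
    (hiy : i ≠ y) {a c : ℕ}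
    (hs : F.At i x a s) (ha : a < F.len i x) (ht : F.At j y c t) (hc : c < F.len j y)
    (hZ : ∀ z ∈ Z, (∀ b ≤ a, ¬ F.At i x b z) ∧ (∀ b ≤ c, ¬ F.At j y b z) ∧
      z ∉ (F.seg i j).support)
    (hodd : Odd (R.length + (a + F.len i j + c))) :
    R.length + (a + F.len i j + c) = 2 * l + 1 := by
  obtain ⟨W, hW, hlen⟩ := exists_route_start hix hs
  have hW1 := hW.step hix ha hij hij.symm (by tauto) (by tauto) (by tauto)
  obtain ⟨W', h1, h2, h3⟩ := hW1.finish hix ha hjy hc ht (by tauto) (by tauto) (by tauto)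
    (by grind)
  rw [Walk.length_append, hlen] at h2
  change W'.length = a + F.len i j + c at h2
  rw [← h2] at hodd ⊢
  refine hR.length_eq hG h1 (fun v hv => ?_) hodd
  rcases h3 v hv with ⟨b, hb', hb⟩ | ⟨n, n', hnn, hP, hn⟩ | ⟨b, hb', hb⟩
  · exact ⟨hb.mem_verts hix, fun h => (hZ v h).1 b hb' hb⟩
  · refine ⟨⟨n, n', hnn, hn⟩, fun h => (hZ v h).2.2 ?_⟩
    rcases hP with hP | ⟨rfl, rfl⟩
    exacts [hP.elim, hn]
  · exact ⟨hb.mem_verts hjy, fun h => (hZ v h).2.1 b hb' hb⟩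

theorem Jump.odd_three {Z : Set V} {s t : V} {R : G.Walk s t} (hG : InFamily l G)
    (hR : F.Jump Z R) {i n j x y : Fin 4} (hin : i ≠ n) (hij : i ≠ j) (hnj : n ≠ j)
    (hix : i ≠ x) (hnx : n ≠ x) (hjy : j ≠ y) (hny : n ≠ y) {a c : ℕ}
    (hs : F.At i x a s) (ha : a < F.len i x) (ht : F.At j y c t) (hc : c < F.len j y)
    (hchord : 2 ≤ F.len i j) (hxj : x = j → a + 2 ≤ F.len i x)
    (hyi : y = i → c + 2 ≤ F.len j y) (hxy : x = j → y = i → a + c + 2 ≤ F.len i x)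
    (hZ : ∀ z ∈ Z, (∀ b ≤ a, ¬ F.At i x b z) ∧ (∀ b ≤ c, ¬ F.At j y b z) ∧
      z ∉ (F.seg i n).support ∧ z ∉ (F.seg n j).support)
    (hodd : Odd (R.length + (a + F.len i n + F.len n j + c))) :
    R.length + (a + F.len i n + F.len n j + c) = 2 * l + 1 := by
  obtain ⟨W, hW, hlen⟩ := exists_route_start hix hs
  have hW1 := hW.step hix ha hin hin.symm (by tauto) (by tauto) (by tauto)
  have hW2 := hW1.step hix ha hnj hij.symm (by grind) (by tauto) (by grind)
  obtain ⟨W', h1, h2, h3⟩ := hW2.finish hix ha hjy hc ht (by tauto) (by grind) (by grind)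
    (by grind)
  rw [Walk.length_append, Walk.length_append, hlen] at h2
  change W'.length = a + F.len i n + F.len n j + c at h2
  rw [← h2] at hodd ⊢
  refine hR.length_eq hG h1 (fun v hv => ?_) hodd
  rcases h3 v hv with ⟨b, hb', hb⟩ | ⟨p, p', hpp, hP, hp⟩ | ⟨b, hb', hb⟩
  · exact ⟨hb.mem_verts hix, fun h => (hZ v h).1 b hb' hb⟩
  · refine ⟨⟨p, p', hpp, hp⟩, fun h => ?_⟩
    rcases hP with (hP | ⟨rfl, rfl⟩) | ⟨rfl, rfl⟩
    exacts [hP.elim, (hZ v h).2.2.1 hp, (hZ v h).2.2.2 hp]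
  · exact ⟨hb.mem_verts hjy, fun h => (hZ v h).2.1 b hb' hb⟩

theorem Jump.odd_four {Z : Set V} {s t : V} {R : G.Walk s t} (hG : InFamily l G)
    (hR : F.Jump Z R) {i n p j x y : Fin 4} (hin : i ≠ n) (hip : i ≠ p) (hij : i ≠ j)
    (hnp : n ≠ p) (hnj : n ≠ j) (hpj : p ≠ j)
    (hix : i ≠ x) (hnx : n ≠ x) (hjy : j ≠ y) (hpy : p ≠ y) {a c : ℕ}
    (hs : F.At i x a s) (ha : a + 2 ≤ F.len i x) (ht : F.At j y c t) (hc : c + 2 ≤ F.len j y)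
    (hip2 : 2 ≤ F.len i p) (hij2 : 2 ≤ F.len i j) (hnj2 : 2 ≤ F.len n j)
    (hxy : x = j → y = i → a + c + 2 ≤ F.len i x)
    (hZ : ∀ z ∈ Z, (∀ b ≤ a, ¬ F.At i x b z) ∧ (∀ b ≤ c, ¬ F.At j y b z) ∧
      z ∉ (F.seg i n).support ∧ z ∉ (F.seg n p).support ∧ z ∉ (F.seg p j).support)
    (hodd : Odd (R.length + (a + F.len i n + F.len n p + F.len p j + c))) :
    R.length + (a + F.len i n + F.len n p + F.len p j + c) = 2 * l + 1 := by
  have ha' : a < F.len i x := by omega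
  obtain ⟨W, hW, hlen⟩ := exists_route_start hix hs
  have hW1 := hW.step hix ha' hin hin.symm (by tauto) (by tauto) (by tauto)
  have hW2 := hW1.step hix ha' hnp hip.symm (by grind) (by tauto) (by grind)
  have hW3 := hW2.step hix ha' hpj hij.symm (by grind) (by tauto) (by grind)
  obtain ⟨W', h1, h2, h3⟩ := hW3.finish hix ha' hjy (by omega) ht (by tauto) (by grind) (by grind)
    (by grind)
  rw [Walk.length_append, Walk.length_append, Walk.length_append, hlen] at h2
  change W'.length = a + F.len i n + F.len n p + F.len p j + c at h2
  rw [← h2] at hodd ⊢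
  refine hR.length_eq hG h1 (fun v hv => ?_) hodd
  rcases h3 v hv with ⟨b, hb', hb⟩ | ⟨q, q', hqq, hP, hq⟩ | ⟨b, hb', hb⟩
  · exact ⟨hb.mem_verts hix, fun h => (hZ v h).1 b hb' hb⟩
  · refine ⟨⟨q, q', hqq, hq⟩, fun h => ?_⟩
    rcases hP with ((hP | ⟨rfl, rfl⟩) | ⟨rfl, rfl⟩) | ⟨rfl, rfl⟩
    exacts [hP.elim, (hZ v h).2.2.1 hq, (hZ v h).2.2.2.1 hq, (hZ v h).2.2.2.2 hq]
  · exact ⟨hb.mem_verts hjy, fun h => (hZ v h).2.1 b hb' hb⟩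

end Frame

/-! ### Restrictions on the ends of jumps -/

/-- The four indices are pairwise different, so they are all of `Fin 4`. -/
structure Distinct (i j k m : Fin 4) : Prop where
  ij : i ≠ j
  ik : i ≠ k
  im : i ≠ m
  jk : j ≠ k
  jm : j ≠ m
  km : k ≠ m

/-- The facts on the lengths of subdivided edges that are used throughout. -/
theorem Distinct.lens {l : ℕ} {i j k m : Fin 4} (hd : Distinct i j k m) (F : Frame G l) :
    F.len k m = F.len i j ∧ F.len j m = F.len i k ∧ F.len j k = F.len i m ∧
      F.len i j + F.len i k + F.len i m = 2 * l + 1 ∧ F.len j i = F.len i j ∧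
      F.len k i = F.len i k ∧ F.len m i = F.len i m ∧ F.len m k = F.len i j ∧
      F.len m j = F.len i k ∧ F.len k j = F.len i m := by
  obtain ⟨e1, e2, e3, e4⟩ := F.len_eqs hd.ij hd.ik hd.im hd.jk hd.jm hd.km
  exact ⟨e1, e2, e3, e4, F.len_symm _ _, F.len_symm _ _, F.len_symm _ _,
    (F.len_symm _ _).trans e1, (F.len_symm _ _).trans e2, (F.len_symm _ _).trans e3⟩

namespace Frame

variable {l : ℕ} {F : Frame G l}

/-- An inner vertex of a subdivided edge lies on no other one. -/
theorem At.notMem {i j n n' : Fin 4} (hij : i ≠ j) (hn : n ≠ n') {b : ℕ} {z : V}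
    (h : F.At i j b z) (h0 : 0 < b) (h1 : b < F.len i j)
    (hne : ¬ ((i = n ∧ j = n') ∨ (i = n' ∧ j = n))) : z ∉ (F.seg n n').support := by
  intro hz
  have hzi : z ≠ F.u i := by
    rintro rfl
    have := h.left_iff
    omega
  obtain ⟨rfl, -⟩ := eq_u_of_mem hij hn h.mem hz hne hzi
  have := h.right_iff
  omega

theorem exists_walk_along {i j : Fin 4} (hij : i ≠ j) {a n : ℕ} {x y : V} (hx : F.At i j a x)
    (hy : F.At i j (a + n) y) :
    ∃ W : G.Walk x y, W.length = n ∧ ∀ v ∈ W.support, v ∈ F.verts := by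
  induction n generalizing y with
  | zero =>
    obtain rfl := hx.eq hy
    refine ⟨Walk.nil, rfl, fun v hv => ?_⟩
    rw [Walk.support_nil, List.mem_singleton] at hv
    exact hv ▸ hx.mem_verts hij
  | succ n ih =>
    have hz : F.At i j (a + n) ((F.seg i j).getVert (a + n)) :=
      ⟨by have := hy.le; omega, rfl⟩
    obtain ⟨W, hW, hWv⟩ := ih hz
    refine ⟨W.concat (adj_of_at hz hy), by rw [Walk.length_concat, hW], fun v hv => ?_⟩
    rw [Walk.support_concat, List.mem_append, List.mem_singleton] at hv
    rcases hv with hv | rfl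
    exacts [hWv v hv, hy.mem_verts hij]

theorem At.symm' {i j : Fin 4} {a b : ℕ} {x : V} (h : F.At i j a x) (hab : F.len i j = a + b) :
    F.At j i b x := by
  have := h.symm
  rwa [hab, Nat.add_sub_cancel_left] at this

/-- A jump cannot bypass a piece of a subdivided edge, even if it has neighbours in that piece: the
girth makes the jump long, while the paths of the subdivision that avoid the piece close it to
holes, one of which is odd and too long. -/
theorem Jump.no_same {Z : Set V} {s t : V} {R : G.Walk s t} (hG : InFamily l G)
    (hR : F.Jump Z R) {i j k m : Fin 4} (hd : Distinct i j k m) {a a' : ℕ}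
    (hs : F.At i j a s) (ht : F.At i j a' t) (haa : a < a')
    (hZ : ∀ z ∈ Z, ∃ b, a < b ∧ b < a' ∧ F.At i j b z) : False := by
  obtain ⟨e1, e2, e3, e4, e5, e6, e7, e8, e9, e10⟩ := hd.lens F
  have lij := len_le (F := F) hG hd.ij
  have lik := len_le (F := F) hG hd.ik
  have lim := len_le (F := F) hG hd.im
  have pik := F.len_pos hd.ik
  have pim := F.len_pos hd.im
  obtain ⟨n, rfl⟩ : ∃ n, a' = a + n := Nat.exists_eq_add_of_le haa.le
  obtain ⟨c, hc⟩ : ∃ c, F.len i j = a + n + c := Nat.exists_eq_add_of_le ht.le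
  have ht' := ht.symm' hc
  have hn : 2 ≤ n := by
    by_contra hlt
    obtain rfl : n = 1 := by omega
    exact hR.not_adj (adj_of_at hs ht)
  have h2 := hR.two_le
  -- the piece itself, and the way round through `u k`, bound the length of the jump from below
  have g1 : 2 * l + 1 ≤ R.length + n := by
    obtain ⟨W, hW, hWv⟩ := exists_walk_along hd.ij hs ht
    exact hW ▸ hR.le_length hG W hWv
  have g2 : 2 * l + 1 ≤ R.length + (a + F.len i k + F.len k j + c) := by
    obtain ⟨W, hW, hWv⟩ := exists_walk_between hd.ij hd.jk.symm hs (at_left k j)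
    obtain ⟨W', hW', hWv'⟩ := exists_walk_between hd.jk.symm hd.ij.symm (at_left k j) ht'
    have := hR.le_length hG (W.append W') (by
      intro v hv
      rw [Walk.mem_support_append_iff] at hv
      exact hv.elim (hWv v) (hWv' v))
    rw [Walk.length_append, hW, hW'] at this
    omega
  have avoid : ∀ z ∈ Z, (∀ b ≤ a, ¬ F.At i j b z) ∧ (∀ b ≤ c, ¬ F.At j i b z) ∧
      ∀ n n', n ≠ n' → ¬ ((i = n ∧ j = n') ∨ (i = n' ∧ j = n)) → z ∉ (F.seg n n').support := by
    intro z hz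
    obtain ⟨b, hab, hba, hb⟩ := hZ z hz
    refine ⟨fun b' hb' h => ?_, fun b' hb' h => ?_, fun n n' hnn hne => ?_⟩
    · have := hb.unique h
      omega
    · have := hb.symm.unique h
      omega
    · exact hb.notMem hd.ij hnn (by omega) (by omega) hne
  by_cases h : (R.length + (a + F.len i k + F.len k j + c)) % 2 = 1
  · have := hR.odd_three hG hd.ik hd.ij hd.jk.symm hd.ij hd.jk.symm hd.ij.symm hd.ik.symm hs
      (by omega) ht' (by omega) (by omega) (by omega) (by omega) (by omega)
      (fun z hz => ⟨(avoid z hz).1, (avoid z hz).2.1,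
        (avoid z hz).2.2 _ _ hd.ik (by cases hd; grind),
        (avoid z hz).2.2 _ _ hd.jk.symm (by cases hd; grind)⟩) (Nat.odd_iff.2 h)
    omega
  have r2 : 2 ≤ F.len i m → R.length + (a + F.len i k + F.len k m + F.len m j + c) = 2 * l + 1 :=
    fun h => hR.odd_four hG hd.ik hd.im hd.ij hd.km hd.jk.symm hd.jm.symm hd.ij hd.jk.symm
      hd.ij.symm hd.im.symm hs (by omega) ht' (by omega) h (by omega) (by omega) (by omega)
      (fun z hz => ⟨(avoid z hz).1, (avoid z hz).2.1,
        (avoid z hz).2.2 _ _ hd.ik (by cases hd; grind),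
        (avoid z hz).2.2 _ _ hd.km (by cases hd; grind),
        (avoid z hz).2.2 _ _ hd.jm.symm (by cases hd; grind)⟩) (Nat.odd_iff.2 (by omega))
  have r3 : 2 ≤ F.len i k → R.length + (a + F.len i m + F.len m k + F.len k j + c) = 2 * l + 1 :=
    fun h => hR.odd_four hG hd.im hd.ik hd.ij hd.km.symm hd.jm.symm hd.jk.symm hd.ij hd.jm.symm
      hd.ij.symm hd.ik.symm hs (by omega) ht' (by omega) h (by omega) (by omega) (by omega)
      (fun z hz => ⟨(avoid z hz).1, (avoid z hz).2.1,
        (avoid z hz).2.2 _ _ hd.im (by cases hd; grind),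
        (avoid z hz).2.2 _ _ hd.km.symm (by cases hd; grind),
        (avoid z hz).2.2 _ _ hd.jk.symm (by cases hd; grind)⟩) (Nat.odd_iff.2 (by omega))
  omega

set_option maxHeartbeats 1000000 in
/-- A clean jump from an inner vertex of `seg i j` to `seg i k`: only possible if it joins
neighbours of `u i` and `seg j k` is an edge. -/
theorem Jump.eq_one_of_adjacent {s t : V} {R : G.Walk s t} (hG : InFamily l G)
    (hR : F.Jump ∅ R) {i j k m : Fin 4} (hd : Distinct i j k m) {a c : ℕ}
    (hs : F.At i j a s) (ha0 : 0 < a) (ha : a < F.len i j) (ht : F.At i k c t) (hc0 : 0 < c) :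
    F.len j k = 1 ∧ a = 1 ∧ c = 1 := by
  obtain ⟨e1, e2, e3, e4, e5, e6, e7, e8, e9, e10⟩ := hd.lens F
  have lij := len_le (F := F) hG hd.ij
  have lik := len_le (F := F) hG hd.ik
  have pim := F.len_pos hd.im
  obtain ⟨b, hb⟩ : ∃ b, F.len i j = a + b := Nat.exists_eq_add_of_le ha.le
  obtain ⟨d, hdd⟩ : ∃ d, F.len i k = c + d := Nat.exists_eq_add_of_le ht.le
  have hs' := hs.symm' hb
  have ht' := ht.symm' hdd
  have h2 := hR.two_le
  have g1 := hR.le_length_of_at hG hd.ij hd.ik hs ht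
  have g2 := hR.le_length_of_at hG hd.ij.symm hd.ik.symm hs' ht'
  rw [len_self] at g1
  -- exactly one of the paths through `u i` and through `u j`, `u k` closes `R` to an odd hole
  by_cases h : (R.length + (a + c)) % 2 = 1
  · have r1 : R.length + (a + c) = 2 * l + 1 := by
      by_cases hck : c = F.len i k
      · subst hck
        obtain rfl := ht.eq (at_right i k)
        have := hR.odd_two hG hd.ik hd.ij hd.jk.symm hd.km hd.im hs ha (at_left k m)
          (by omega) (by simp) (Nat.odd_iff.2 (by omega))
        omega
      · exact hR.odd_one hG hd.ij hd.ik hd.jk hs ha ht (by omega) (Nat.odd_iff.2 h)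
    by_cases hq : 2 ≤ F.len j k
    · have := hR.odd_three hG hd.jm hd.jk hd.km.symm hd.ij.symm hd.im.symm hd.ik.symm hd.im.symm
        hs' (by omega) ht' (by omega) hq (fun h => absurd h hd.ik) (fun h => absurd h hd.ij)
        (fun h => absurd h hd.ik) (by simp) (Nat.odd_iff.2 (by omega))
      omega
    · have f1 : F.len j k = 1 := by omega
      have f2 : F.len i j = l := by omega
      have f3 : F.len i k = l := by omega
      have f4 : l ≤ b + d := by omega
      clear g1 g2 h hq lij lik pim
      refine ⟨f1, ?_, ?_⟩
      · by_contra ha1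
        have ha2 : 2 ≤ a := by omega
        have hd2 : 2 ≤ d := by omega
        have hl2 : 2 ≤ l := by omega
        clear ha1
        have hodd : Odd (R.length + (b + F.len j k + F.len k m + F.len m i + c)) := by
          rw [Nat.odd_iff]
          omega
        have := hR.odd_four hG hd.jk hd.jm hd.ij.symm hd.km hd.ik.symm hd.im.symm hd.ij.symm
          hd.ik.symm hd.ik hd.km.symm hs' (by omega) ht (by omega) (by omega) (by omega) (by omega)
          (fun _ h => absurd h hd.jk.symm) (by simp) hodd
        omega
      · by_contra hc1
        have hc2 : 2 ≤ c := by omega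
        have hb2 : 2 ≤ b := by omega
        have hl2 : 2 ≤ l := by omega
        clear hc1
        have hodd : Odd (R.length + (a + F.len i m + F.len m j + F.len j k + d)) := by
          rw [Nat.odd_iff]
          omega
        have := hR.odd_four hG hd.im hd.ij hd.ik hd.jm.symm hd.km.symm hd.jk hd.ij hd.jm.symm
          hd.ik.symm hd.ij.symm hs (by omega) ht' (by omega) (by omega) (by omega) (by omega)
          (fun h => absurd h hd.jk) (by simp) hodd
        omega
  · have h1 := hR.odd_two hG hd.jk hd.ij.symm hd.ik.symm hd.ik.symm hd.ij.symm hs' (by omega) ht'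
      (by omega) (by simp) (Nat.odd_iff.2 (by omega))
    have := hR.odd_three hG hd.im hd.ik hd.km.symm hd.ij hd.jm.symm hd.ik.symm hd.im.symm hs ha ht'
      (by omega) (by omega) (fun h => absurd h hd.jk) (by omega) (fun h => absurd h hd.jk) (by simp)
      (Nat.odd_iff.2 (by omega))
    omega

/-- The length and the ends of a clean jump between inner vertices of opposite subdivided edges. -/
theorem Jump.opposite {s t : V} {R : G.Walk s t} (hG : InFamily l G)
    (hR : F.Jump ∅ R) {i j k m : Fin 4} (hd : Distinct i j k m) {a c : ℕ}
    (hs : F.At i j a s) (ha0 : 0 < a) (ha : a < F.len i j) (ht : F.At k m c t) (hc0 : 0 < c)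
    (hc : c < F.len k m) :
    (R.length = F.len i m ∧ a + c = F.len i j) ∨ (R.length = F.len i k ∧ a = c) := by
  obtain ⟨e1, e2, e3, e4, e5, e6, e7, e8, e9, e10⟩ := hd.lens F
  obtain ⟨b, hb⟩ : ∃ b, F.len i j = a + b := Nat.exists_eq_add_of_le ha.le
  obtain ⟨d, hdd⟩ : ∃ d, F.len k m = c + d := Nat.exists_eq_add_of_le hc.le
  have hs' := hs.symm' hb
  have ht' := ht.symm' hdd
  by_cases h : (R.length + (a + F.len i k + c)) % 2 = 1
  · have := hR.odd_two hG hd.ik hd.ij hd.jk.symm hd.km hd.im hs ha ht hc (by simp)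
      (Nat.odd_iff.2 h)
    have := hR.odd_two hG hd.jm hd.ij.symm hd.im.symm hd.km.symm hd.jk hs' (by omega) ht'
      (by omega) (by simp) (Nat.odd_iff.2 (by omega))
    left
    omega
  · have := hR.odd_two hG hd.im hd.ij hd.jm.symm hd.km.symm hd.ik hs ha ht' (by omega) (by simp)
      (Nat.odd_iff.2 (by omega))
    have := hR.odd_two hG hd.jk hd.ij.symm hd.ik.symm hd.km hd.jm hs' (by omega) ht hc (by simp)
      (Nat.odd_iff.2 (by omega))
    right
    omega

/-- If all lengths are at least `2` and the lengths other than that of `seg i j` are below `l`,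
there are no clean jumps between inner vertices of `seg i j` and `seg k m`: in both cases of
`Jump.opposite` a path through four branch vertices has the wrong length. -/
theorem Jump.no_opposite {s t : V} {R : G.Walk s t} (hG : InFamily l G)
    (hR : F.Jump ∅ R) {i j k m : Fin 4} (hd : Distinct i j k m) {a c : ℕ}
    (hs : F.At i j a s) (ha0 : 0 < a) (ha : a < F.len i j) (ht : F.At k m c t) (hc0 : 0 < c)
    (hc : c < F.len k m) (hik2 : 2 ≤ F.len i k) (hikl : F.len i k < l) (him2 : 2 ≤ F.len i m)
    (himl : F.len i m < l) : False := by
  have main : ∀ {i j k m : Fin 4}, Distinct i j k m → ∀ {a c : ℕ} {s t : V} {R : G.Walk s t},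
      F.Jump ∅ R → F.At i j a s → 0 < a →
      a < F.len i j → F.At k m c t → 0 < c → c < F.len k m → 2 ≤ F.len i k → F.len i m < l →
      R.length = F.len i m → a + c = F.len i j → False := by
    intro i j k m hd a c s t R hR hs ha0 ha ht hc0 hc hik2 himl hRlen hac
    obtain ⟨e1, e2, e3, e4, e5, e6, e7, e8, e9, e10⟩ := hd.lens F
    have g1 := hR.le_length_of_at hG hd.ij hd.km.symm hs (ht.symm' (b := a) (by omega))
    have g2 := hR.le_length_of_at hG hd.ij.symm hd.km (hs.symm' (b := c) (by omega)) ht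
    have := hR.odd_four hG hd.im hd.ij hd.ik hd.jm.symm hd.km.symm hd.jk hd.ij hd.jm.symm hd.km
      hd.jm hs (by omega) ht (by omega) (by omega) hik2 (by omega) (fun h => absurd h hd.jk)
      (by simp) (Nat.odd_iff.2 (by omega))
    omega
  -- the two cases of `Jump.opposite` are interchanged by swapping `k` and `m`
  obtain ⟨e1, -⟩ := hd.lens F
  rcases hR.opposite hG hd hs ha0 ha ht hc0 hc with ⟨h1, h2⟩ | ⟨h1, h2⟩
  · exact main hd hR hs ha0 ha ht hc0 hc hik2 himl h1 h2
  · have ht' := ht.symm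
    have hlen := F.len_symm k m
    exact main ⟨hd.ij, hd.im, hd.ik, hd.jm, hd.jk, hd.km.symm⟩ hR hs ha0 ha ht' (by omega)
      (by omega) him2 hikl h1 (by omega)

/-- No jump joins two neighbours of a branch vertex `u i` on different subdivided edges, even if it
has neighbours equal to `u i`, unless the subdivided edge opposite in the triangle is an edge. -/
theorem Jump.no_star {s t : V} {R : G.Walk s t} (hG : InFamily l G) {i j k m : Fin 4}
    (hR : F.Jump {F.u i} R) (hd : Distinct i j k m)
    (hs : F.At i j 1 s) (ht : F.At i k 1 t) (hjk2 : 2 ≤ F.len j k) : False := by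
  obtain ⟨e1, e2, e3, e4, e5, e6, e7, e8, e9, e10⟩ := hd.lens F
  have lim := len_le (F := F) hG hd.im
  have hs' := hs.symm
  have ht' := ht.symm
  have hl1 := hs.le
  have hl2 := ht.le
  have g1 := hR.le_length_of_at hG hd.ij hd.ik hs ht
  rw [len_self] at g1
  have avoid : ∀ z ∈ ({F.u i} : Set V), (∀ b ≤ F.len i j - 1, ¬ F.At j i b z) ∧
      (∀ b ≤ F.len i k - 1, ¬ F.At k i b z) ∧
      ∀ n n', n ≠ n' → i ≠ n → i ≠ n' → z ∉ (F.seg n n').support := by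
    rintro z rfl
    refine ⟨fun b hb h => ?_, fun b hb h => ?_, fun n n' hnn h1 h2 h => ?_⟩
    · have := h.right_iff
      omega
    · have := h.right_iff
      omega
    · exact (u_mem_seg hnn h).elim h1 h2
  have r1 := hR.odd_two hG hd.jk hd.ij.symm hd.ik.symm hd.ik.symm hd.ij.symm hs' (by omega)
    ht' (by omega)
    fun z hz => ⟨(avoid z hz).1, (avoid z hz).2.1, (avoid z hz).2.2 _ _ hd.jk hd.ij hd.ik⟩
  have r2 := hR.odd_three hG hd.jm hd.jk hd.km.symm hd.ij.symm hd.im.symm hd.ik.symm hd.im.symm hs'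
    (by omega) ht' (by omega) hjk2 (fun h => absurd h hd.ik) (fun h => absurd h hd.ij)
    (fun h => absurd h hd.ik)
    fun z hz => ⟨(avoid z hz).1, (avoid z hz).2.1, (avoid z hz).2.2 _ _ hd.jm hd.ij hd.im,
      (avoid z hz).2.2 _ _ hd.km.symm hd.im hd.ik⟩
  rw [Nat.odd_iff] at r1 r2
  omega

/-- The variant of `Jump.no_star` for lengths `l`, `l` and `1` in which the exceptional vertex is
the neighbour `z` of `u i` on `seg i j` and the jump starts at the next vertex of `seg i j`. -/
theorem Jump.no_star_of_len_eq_one {s t z : V} {R : G.Walk s t} (hG : InFamily l G) (hl : 4 ≤ l)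
    {i j k m : Fin 4} (hR : F.Jump {z} R) (hd : Distinct i j k m) (hij' : F.len i j = l)
    (him' : F.len i m = l) (hz : F.At i j 1 z) (hs : F.At i j 2 s) (ht : F.At i m 1 t) :
    False := by
  obtain ⟨e1, e2, e3, e4, e5, e6, e7, e8, e9, e10⟩ := hd.lens F
  have hs' := hs.symm
  have h2 := hR.two_le
  have avoid : ∀ z' ∈ ({z} : Set V), (∀ b ≤ F.len i j - 2, ¬ F.At j i b z') ∧
      (∀ b ≤ 1, ¬ F.At i m b z') ∧
      ∀ n n', n ≠ n' → ¬ ((i = n ∧ j = n') ∨ (i = n' ∧ j = n)) → z' ∉ (F.seg n n').support := by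
    rintro z' rfl
    have key : ∀ n n', n ≠ n' → ¬ ((i = n ∧ j = n') ∨ (i = n' ∧ j = n)) →
        z' ∉ (F.seg n n').support :=
      fun n n' hnn hne => hz.notMem hd.ij hnn (by omega) (by omega) hne
    refine ⟨fun b hb h => ?_, fun b hb h => ?_, key⟩
    · have := hz.symm.unique h
      omega
    · exact key i m hd.im (by cases hd; grind) h.mem
  have r1 := hR.odd_three hG hd.jk hd.ij.symm hd.ik.symm hd.ij.symm hd.ik.symm hd.im hd.km hs'
    (by omega) ht (by omega) (by omega) (by omega) (fun h => absurd h hd.jm.symm)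
    (fun _ h => absurd h hd.jm.symm)
    fun z hz => ⟨(avoid z hz).1, (avoid z hz).2.1, (avoid z hz).2.2 _ _ hd.jk (by cases hd; grind),
      (avoid z hz).2.2 _ _ hd.ik.symm (by cases hd; grind)⟩
  have r2 := hR.odd_four hG hd.jm hd.jk hd.ij.symm hd.km.symm hd.im.symm hd.ik.symm hd.ij.symm
    hd.im.symm hd.im hd.km hs' (by omega) ht (by omega) (by omega) (by omega) (by omega)
    (fun _ h => absurd h hd.jm.symm)
    fun z hz => ⟨(avoid z hz).1, (avoid z hz).2.1, (avoid z hz).2.2 _ _ hd.jm (by cases hd; grind),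
      (avoid z hz).2.2 _ _ hd.km.symm (by cases hd; grind),
      (avoid z hz).2.2 _ _ hd.ik.symm (by cases hd; grind)⟩
  rw [Nat.odd_iff] at r1 r2
  omega

end Frame

namespace K4Subdivision

/-! ### From `K₄`-subdivisions to frames -/

/-- The branch vertices of a `K₄`-subdivision as a family indexed by `Fin 4`. -/
def vert (H : K4Subdivision G) : Fin 4 → V
  | 0 => H.u₁
  | 1 => H.u₂
  | 2 => H.u₃
  | 3 => H.u₄

/-- The arrises of a `K₄`-subdivision in both orientations, indexed by pairs of branch vertices. -/
def arris (H : K4Subdivision G) : ∀ i j : Fin 4, G.Walk (H.vert i) (H.vert j)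
  | 0, 0 => Walk.nil
  | 0, 1 => H.P₁
  | 0, 2 => H.L₁
  | 0, 3 => H.Q₂
  | 1, 0 => H.P₁.reverse
  | 1, 1 => Walk.nil
  | 1, 2 => H.Q₁
  | 1, 3 => H.L₂
  | 2, 0 => H.L₁.reverse
  | 2, 1 => H.Q₁.reverse
  | 2, 2 => Walk.nil
  | 2, 3 => H.P₂
  | 3, 0 => H.Q₂.reverse
  | 3, 1 => H.L₂.reverse
  | 3, 2 => H.P₂.reverse
  | 3, 3 => Walk.nil

theorem mem_support_of_mem_reverse {a b x : V} {p : G.Walk a b} (h : x ∈ p.reverse.support) :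
    x ∈ p.support := by
  simpa using h

theorem mem_of_mem_arris (H : K4Subdivision G) {i j : Fin 4} (hij : i < j) {x : V}
    (hx : x ∈ (H.arris i j).support) :
    x ∈ H.P₁.support ∨ x ∈ H.L₁.support ∨ x ∈ H.Q₂.support ∨ x ∈ H.Q₁.support ∨
      x ∈ H.L₂.support ∨ x ∈ H.P₂.support := by
  fin_cases i <;> fin_cases j <;> first
    | exact absurd hij (by decide)
    | exact Or.inl hx
    | exact Or.inr (Or.inl hx)
    | exact Or.inr (Or.inr (Or.inl hx))
    | exact Or.inr (Or.inr (Or.inr (Or.inl hx)))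
    | exact Or.inr (Or.inr (Or.inr (Or.inr (Or.inl hx))))
    | exact Or.inr (Or.inr (Or.inr (Or.inr (Or.inr hx))))

/-- A `K₄`-subdivision that is induced and whose four face cycles have length `2l + 1`, as a
frame. -/
def toFrame (H : K4Subdivision G) (l : ℕ)
    (h₁ : H.P₁.length + H.Q₁.length + H.L₁.length = 2 * l + 1)
    (h₂ : H.P₁.length + H.L₂.length + H.Q₂.length = 2 * l + 1)
    (h₃ : H.Q₁.length + H.P₂.length + H.L₂.length = 2 * l + 1)
    (h₄ : H.L₁.length + H.P₂.length + H.Q₂.length = 2 * l + 1)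
    (hind : ∀ i j k m x y, i < j → k < m → x ∈ (H.arris i j).support →
      y ∈ (H.arris k m).support → G.Adj x y → ∃ e f, e ≠ f ∧ s(x, y) ∈ (H.arris e f).edges) :
    Frame G l where
  u := H.vert
  seg := H.arris
  inj := by
    intro i j hij
    have := H.nodup
    fin_cases i <;> fin_cases j <;> simp [vert] at hij ⊢ <;> simp_all
  seg_symm := by
    intro i j
    fin_cases i <;> fin_cases j <;> first
      | rfl
      | exact (Walk.reverse_reverse _).symm
  isPath := by
    intro i j
    fin_cases i <;> fin_cases j <;> first
      | exact Walk.IsPath.nil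
      | exact H.isPath_P₁
      | exact H.isPath_P₂
      | exact H.isPath_Q₁
      | exact H.isPath_Q₂
      | exact H.isPath_L₁
      | exact H.isPath_L₂
      | exact H.isPath_P₁.reverse
      | exact H.isPath_P₂.reverse
      | exact H.isPath_Q₁.reverse
      | exact H.isPath_Q₂.reverse
      | exact H.isPath_L₁.reverse
      | exact H.isPath_L₂.reverse
  meet := by
    intro i j k x hij hik hjk hx hx'
    have f1 := H.meet_P₁_Q₂ x
    have f2 := H.meet_P₁_L₁ x
    have f3 := H.meet_Q₂_L₁ x
    have f4 := H.meet_P₁_Q₁ x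
    have f5 := H.meet_P₁_L₂ x
    have f6 := H.meet_Q₁_L₂ x
    have f7 := H.meet_P₂_Q₁ x
    have f8 := H.meet_P₂_L₁ x
    have f9 := H.meet_Q₁_L₁ x
    have f10 := H.meet_P₂_Q₂ x
    have f11 := H.meet_P₂_L₂ x
    have f12 := H.meet_Q₂_L₂ x
    fin_cases i <;> fin_cases j <;> fin_cases k <;>
      first
      | exact absurd rfl hij
      | exact absurd rfl hik
      | exact absurd rfl hjk
      | (simp only [arris] at hx hx'
         simp only [vert]
         try replace hx := mem_support_of_mem_reverse hx
         try replace hx' := mem_support_of_mem_reverse hx'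
         first
         | exact f1 hx hx' | exact f1 hx' hx | exact f2 hx hx' | exact f2 hx' hx
         | exact f3 hx hx' | exact f3 hx' hx | exact f4 hx hx' | exact f4 hx' hx
         | exact f5 hx hx' | exact f5 hx' hx | exact f6 hx hx' | exact f6 hx' hx
         | exact f7 hx hx' | exact f7 hx' hx | exact f8 hx hx' | exact f8 hx' hx
         | exact f9 hx hx' | exact f9 hx' hx | exact f10 hx hx' | exact f10 hx' hx
         | exact f11 hx hx' | exact f11 hx' hx | exact f12 hx hx' | exact f12 hx' hx)
  disj := by
    intro i j k m x hij hik him hjk hjm hkm hx hx'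
    have f1 := H.disj_P x
    have f2 := H.disj_Q x
    have f3 := H.disj_L x
    fin_cases i <;> fin_cases j <;> first
      | exact absurd rfl hij
      | (fin_cases k <;> first
          | exact absurd rfl hik
          | exact absurd rfl hjk
          | (fin_cases m <;> first
              | exact absurd rfl him
              | exact absurd rfl hjm
              | exact absurd rfl hkm
              | (simp only [arris] at hx hx'
                 try replace hx := mem_support_of_mem_reverse hx
                 try replace hx' := mem_support_of_mem_reverse hx'
                 first
                 | exact f1 hx hx' | exact f1 hx' hx | exact f2 hx hx' | exact f2 hx' hx
                 | exact f3 hx hx' | exact f3 hx' hx)))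
  length_triangle := by
    have e : ∀ i j, (H.arris i j).length =
        (![![0, H.P₁.length, H.L₁.length, H.Q₂.length], ![H.P₁.length, 0, H.Q₁.length, H.L₂.length],
          ![H.L₁.length, H.Q₁.length, 0, H.P₂.length],
          ![H.Q₂.length, H.L₂.length, H.P₂.length, 0]] : Fin 4 → Fin 4 → ℕ) i j := by
      intro i j
      fin_cases i <;> fin_cases j <;> first
        | rfl
        | exact Walk.length_reverse _
    intro i j k hij hik hjk
    rw [e, e, e]
    fin_cases i <;> fin_cases j <;> first
      | exact absurd rfl hij
      | (fin_cases k <;> first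
          | exact absurd rfl hik
          | exact absurd rfl hjk
          | (clear e
             simp
             omega))
  induced := by
    intro i j k m x y hij hkm hx hy hxy
    have hrev : ∀ i j, (H.arris j i).support = (H.arris i j).support.reverse := by
      intro i j
      fin_cases i <;> fin_cases j <;> first
        | rfl
        | exact Walk.support_reverse _
        | exact (List.reverse_eq_iff.1 (Walk.support_reverse _).symm)
    rcases lt_or_gt_of_ne hij with h | h <;> rcases lt_or_gt_of_ne hkm with h' | h'
    · exact hind i j k m x y h h' hx hy hxy
    · exact hind i j m k x y h h' hx (by rw [hrev k m, List.mem_reverse]; exact hy) hxy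
    · exact hind j i k m x y h h' (by rw [hrev i j, List.mem_reverse]; exact hx) hy hxy
    · exact hind j i m k x y h h' (by rw [hrev i j, List.mem_reverse]; exact hx)
        (by rw [hrev k m, List.mem_reverse]; exact hy) hxy

theorem exists_frame (H : K4Subdivision G) (l : ℕ)
    (h₁ : H.P₁.length + H.Q₁.length + H.L₁.length = 2 * l + 1)
    (h₂ : H.P₁.length + H.L₂.length + H.Q₂.length = 2 * l + 1)
    (h₃ : H.Q₁.length + H.P₂.length + H.L₂.length = 2 * l + 1)
    (h₄ : H.L₁.length + H.P₂.length + H.Q₂.length = 2 * l + 1)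
    (hind : ∀ i j k m x y, i < j → k < m → x ∈ (H.arris i j).support →
      y ∈ (H.arris k m).support → G.Adj x y → ∃ e f, e ≠ f ∧ s(x, y) ∈ (H.arris e f).edges) :
    ∃ F : Frame G l, F.len 0 2 = H.L₁.length ∧ F.len 0 3 = H.Q₂.length :=
  ⟨H.toFrame l h₁ h₂ h₃ h₄ hind, rfl, rfl⟩

end K4Subdivision

/-- An edge joining the ends of a walk that is shorter than the girth allows lies on the walk. -/
theorem mem_edges_or_le_length {g : ℕ} (hg : (g : ℕ∞) ≤ G.egirth) {x y : V} (hxy : G.Adj x y)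
    (q : G.Walk x y) : s(x, y) ∈ q.edges ∨ g ≤ 1 + q.length := by
  classical
  by_cases h : hxy.toWalk = q.bypass
  · left
    refine q.edges_bypass_subset_edges ?_
    rw [← h]
    simp
  · right
    obtain ⟨w, -, -, c, hc, hle⟩ :=
      (Walk.IsPath.of_adj hxy).exists_isCycle_length_le_add_of_ne q.bypass_isPath h
    have h1 : (g : ℕ∞) ≤ c.length := hg.trans (egirth_le_length hc)
    have h2 : g ≤ c.length := by exact_mod_cast h1
    have := q.length_bypass_le_length
    have h3 : hxy.toWalk.length = 1 := by simp
    omega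

/-- In a `K₄`-subdivision with faces of length `2l + 1` in a graph of girth `2l + 1` there are no
additional edges between opposite arrises `A` and `B`. -/
theorem mem_edges_of_opposite {l : ℕ} (hl : 2 ≤ l) (hg : ((2 * l + 1 : ℕ) : ℕ∞) ≤ G.egirth)
    {a b c d : V} {A : G.Walk a b} {B : G.Walk c d} {ac : G.Walk a c} {ad : G.Walk a d}
    {bc : G.Walk b c} {bd : G.Walk b d} (hac : ac.IsPath) (hbc : bc.IsPath)
    (hc : ∀ x ∈ ac.support, x ∈ bc.support → x = c) (hcad : c ∉ ad.support)
    (hcbd : c ∉ bd.support) (h₁ : A.length + ac.length + bc.length = 2 * l + 1)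
    (h₂ : A.length + ad.length + bd.length = 2 * l + 1)
    (h₃ : B.length + ac.length + ad.length = 2 * l + 1)
    (h₄ : B.length + bc.length + bd.length = 2 * l + 1) {x y : V} (hx : x ∈ A.support)
    (hy : y ∈ B.support) (hxy : G.Adj x y) :
    s(x, y) ∈ A.edges ∨ s(x, y) ∈ B.edges ∨ s(x, y) ∈ ac.edges ∨ s(x, y) ∈ ad.edges ∨
      s(x, y) ∈ bc.edges ∨ s(x, y) ∈ bd.edges := by
  classical
  have hquad := le_length_add_length hg
    (isPath_append hac hbc.reverse (fun x hx hx' => hc x hx (by simpa using hx')))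
    (ad.append bd.reverse) (x := c) (by simp) (by simp [hcad, hcbd])
  by_contra! hno
  obtain ⟨n1, n2, n3, n4, n5, n6⟩ := hno
  have hA := congrArg Walk.edges (A.take_spec hx)
  have hB := congrArg Walk.edges (B.take_spec hy)
  have hA' := congrArg Walk.length (A.take_spec hx)
  have hB' := congrArg Walk.length (B.take_spec hy)
  rw [Walk.length_append] at hA' hB'
  rw [← hA] at n1
  rw [← hB] at n2
  rw [Walk.edges_append, List.mem_append, not_or] at n1 n2
  have k1 := (mem_edges_or_le_length hg hxy
    (((A.takeUntil x hx).reverse.append ac).append (B.takeUntil y hy))).resolve_left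
      (by simp [n1, n2, n3])
  have k2 := (mem_edges_or_le_length hg hxy
    (((A.takeUntil x hx).reverse.append ad).append (B.dropUntil y hy).reverse)).resolve_left
      (by simp [n1, n2, n4])
  have k3 := (mem_edges_or_le_length hg hxy
    (((A.dropUntil x hx).append bc).append (B.takeUntil y hy))).resolve_left
      (by simp [n1, n2, n5])
  have k4 := (mem_edges_or_le_length hg hxy
    (((A.dropUntil x hx).append bd).append (B.dropUntil y hy).reverse)).resolve_left
      (by simp [n1, n2, n6])
  simp only [Walk.length_append, Walk.length_reverse] at k1 k2 k3 k4 hquad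
  omega

namespace K4Subdivision

/-- Edges within a face belong to the subdivision as faces are induced, and edges between opposite
arrises do so by `mem_edges_of_opposite`. -/
theorem nonempty_frame {l : ℕ} (hl : 2 ≤ l) (hG : InFamily l G) (H : K4Subdivision G)
    (hH : H.IsOdd) : Nonempty (Frame G l) := by
  obtain ⟨⟨hC1, o1⟩, ⟨hC2, o2⟩, ⟨hC3, o3⟩, ⟨hC4, o4⟩⟩ := hH
  have l1 := hG.length_eq hC1 o1
  have l2 := hG.length_eq hC2 o2
  have l3 := hG.length_eq hC3 o3
  have l4 := hG.length_eq hC4 o4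
  simp only [C₁, C₂, C₃, C₄, Walk.length_append, Walk.length_reverse] at l1 l2 l3 l4
  have c1 : ∀ x y, (x ∈ H.P₁.support ∨ x ∈ H.Q₁.support ∨ x ∈ H.L₁.support) →
      (y ∈ H.P₁.support ∨ y ∈ H.Q₁.support ∨ y ∈ H.L₁.support) → G.Adj x y →
      ∃ e f, e ≠ f ∧ s(x, y) ∈ (H.arris e f).edges := by
    intro x y hx hy hxy
    have := hC1.2.1.mem_edges (u' := x) (v' := y) (by simpa [C₁, or_assoc] using hx)
      (by simpa [C₁, or_assoc] using hy) hxy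
    simp only [C₁, Walk.edges_append, Walk.edges_reverse, List.mem_append, List.mem_reverse] at this
    rcases this with (h | h) | h
    exacts [⟨0, 1, by decide, h⟩, ⟨1, 2, by decide, h⟩, ⟨0, 2, by decide, h⟩]
  have c2 : ∀ x y, (x ∈ H.P₁.support ∨ x ∈ H.L₂.support ∨ x ∈ H.Q₂.support) →
      (y ∈ H.P₁.support ∨ y ∈ H.L₂.support ∨ y ∈ H.Q₂.support) → G.Adj x y →
      ∃ e f, e ≠ f ∧ s(x, y) ∈ (H.arris e f).edges := by
    intro x y hx hy hxy
    have := hC2.2.1.mem_edges (u' := x) (v' := y) (by simpa [C₂, or_assoc] using hx)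
      (by simpa [C₂, or_assoc] using hy) hxy
    simp only [C₂, Walk.edges_append, Walk.edges_reverse, List.mem_append, List.mem_reverse] at this
    rcases this with (h | h) | h
    exacts [⟨0, 1, by decide, h⟩, ⟨1, 3, by decide, h⟩, ⟨0, 3, by decide, h⟩]
  have c3 : ∀ x y, (x ∈ H.P₂.support ∨ x ∈ H.L₂.support ∨ x ∈ H.Q₁.support) →
      (y ∈ H.P₂.support ∨ y ∈ H.L₂.support ∨ y ∈ H.Q₁.support) → G.Adj x y →
      ∃ e f, e ≠ f ∧ s(x, y) ∈ (H.arris e f).edges := by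
    intro x y hx hy hxy
    have := hC3.2.1.mem_edges (u' := x) (v' := y) (by simpa [C₃, or_assoc] using hx)
      (by simpa [C₃, or_assoc] using hy) hxy
    simp only [C₃, Walk.edges_append, Walk.edges_reverse, List.mem_append, List.mem_reverse] at this
    rcases this with (h | h) | h
    exacts [⟨2, 3, by decide, h⟩, ⟨1, 3, by decide, h⟩, ⟨1, 2, by decide, h⟩]
  have c4 : ∀ x y, (x ∈ H.L₁.support ∨ x ∈ H.P₂.support ∨ x ∈ H.Q₂.support) →
      (y ∈ H.L₁.support ∨ y ∈ H.P₂.support ∨ y ∈ H.Q₂.support) → G.Adj x y →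
      ∃ e f, e ≠ f ∧ s(x, y) ∈ (H.arris e f).edges := by
    intro x y hx hy hxy
    have := hC4.2.1.mem_edges (u' := x) (v' := y) (by simpa [C₄, or_assoc] using hx)
      (by simpa [C₄, or_assoc] using hy) hxy
    simp only [C₄, Walk.edges_append, Walk.edges_reverse, List.mem_append, List.mem_reverse] at this
    rcases this with (h | h) | h
    exacts [⟨0, 2, by decide, h⟩, ⟨2, 3, by decide, h⟩, ⟨0, 3, by decide, h⟩]
  have oP : ∀ x y, x ∈ H.P₁.support → y ∈ H.P₂.support → G.Adj x y →
      ∃ e f, e ≠ f ∧ s(x, y) ∈ (H.arris e f).edges := by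
    intro x y hx hy hxy
    rcases mem_edges_of_opposite hl hG.1.ge (ad := H.Q₂) (bd := H.L₂) H.isPath_L₁ H.isPath_Q₁
      (fun x h h' => H.meet_Q₁_L₁ x h' h) (H.disj_Q _ (Walk.end_mem_support _))
      (H.disj_L _ (Walk.end_mem_support _)) (by omega) (by omega) (by omega) (by omega) hx hy hxy
      with h | h | h | h | h | h
    exacts [⟨0, 1, by decide, h⟩, ⟨2, 3, by decide, h⟩, ⟨0, 2, by decide, h⟩,
      ⟨0, 3, by decide, h⟩, ⟨1, 2, by decide, h⟩, ⟨1, 3, by decide, h⟩]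
  have oL : ∀ x y, x ∈ H.L₁.support → y ∈ H.L₂.support → G.Adj x y →
      ∃ e f, e ≠ f ∧ s(x, y) ∈ (H.arris e f).edges := by
    intro x y hx hy hxy
    rcases mem_edges_of_opposite hl hG.1.ge (ad := H.Q₂) (bd := H.P₂) H.isPath_P₁
      H.isPath_Q₁.reverse (fun x h h' => H.meet_P₁_Q₁ x h (by simpa using h'))
      (H.disj_Q _ (Walk.start_mem_support _)) (H.disj_P _ (Walk.end_mem_support _))
      (by rw [Walk.length_reverse]; omega) (by omega) (by omega)
      (by rw [Walk.length_reverse]; omega) hx hy hxy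
      with h | h | h | h | h | h
    exacts [⟨0, 2, by decide, h⟩, ⟨1, 3, by decide, h⟩, ⟨0, 1, by decide, h⟩,
      ⟨0, 3, by decide, h⟩, ⟨2, 1, by decide, h⟩, ⟨2, 3, by decide, h⟩]
  have oQ : ∀ x y, x ∈ H.Q₁.support → y ∈ H.Q₂.support → G.Adj x y →
      ∃ e f, e ≠ f ∧ s(x, y) ∈ (H.arris e f).edges := by
    intro x y hx hy hxy
    rcases mem_edges_of_opposite hl hG.1.ge (ad := H.L₂) (bd := H.P₂) H.isPath_P₁.reverse
      H.isPath_L₁.reverse (fun x h h' => H.meet_P₁_L₁ x (by simpa using h) (by simpa using h'))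
      (H.disj_L _ (Walk.start_mem_support _)) (H.disj_P _ (Walk.start_mem_support _))
      (by simp only [Walk.length_reverse]; omega) (by omega)
      (by simp only [Walk.length_reverse]; omega) (by simp only [Walk.length_reverse]; omega)
      hx hy hxy
      with h | h | h | h | h | h
    exacts [⟨1, 2, by decide, h⟩, ⟨0, 3, by decide, h⟩, ⟨1, 0, by decide, h⟩,
      ⟨1, 3, by decide, h⟩, ⟨2, 0, by decide, h⟩, ⟨2, 3, by decide, h⟩]
  have swap : ∀ {x y}, (∃ e f, e ≠ f ∧ s(y, x) ∈ (H.arris e f).edges) →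
      ∃ e f, e ≠ f ∧ s(x, y) ∈ (H.arris e f).edges := by
    intro x y h
    rwa [Sym2.eq_swap] at h
  refine (H.exists_frame l (by omega) (by omega) (by omega) (by omega) ?_).nonempty
  intro i j k m x y hij hkm hx hy hxy
  rcases H.mem_of_mem_arris hij hx with hx | hx | hx | hx | hx | hx <;>
    rcases H.mem_of_mem_arris hkm hy with hy | hy | hy | hy | hy | hy <;>
    first
    | exact oP x y hx hy hxy
    | exact oQ x y hx hy hxy
    | exact oL x y hx hy hxy
    | exact swap (oP y x hy hx hxy.symm)
    | exact swap (oQ y x hy hx hxy.symm)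
    | exact swap (oL y x hy hx hxy.symm)
    | exact c1 x y (by simp only [hx, true_or, or_true]) (by simp only [hy, true_or, or_true]) hxy
    | exact c2 x y (by simp only [hx, true_or, or_true]) (by simp only [hy, true_or, or_true]) hxy
    | exact c3 x y (by simp only [hx, true_or, or_true]) (by simp only [hy, true_or, or_true]) hxy
    | exact c4 x y (by simp only [hx, true_or, or_true]) (by simp only [hy, true_or, or_true]) hxy

end K4Subdivision

/-! ### Minimal jumps -/

theorem exists_walk_getVert {u v : V} (p : G.Walk u v) {m n : ℕ} (hmn : m ≤ n)
    (hn : n ≤ p.length) :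
    ∃ W : G.Walk (p.getVert m) (p.getVert n),
      ∀ x ∈ W.support, ∃ b, m ≤ b ∧ b ≤ n ∧ p.getVert b = x := by
  induction n, hmn using Nat.le_induction with
  | base =>
    refine ⟨Walk.nil, fun x hx => ⟨m, le_rfl, le_rfl, ?_⟩⟩
    rw [Walk.support_nil, List.mem_singleton] at hx
    exact hx.symm
  | succ n hmn ih =>
    obtain ⟨W, hW⟩ := ih (by omega)
    refine ⟨W.concat (p.adj_getVert_succ hn), fun x hx => ?_⟩
    rw [Walk.support_concat, List.mem_append, List.mem_singleton] at hx
    rcases hx with hx | rfl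
    · obtain ⟨b, h1, h2, h3⟩ := hW x hx
      exact ⟨b, h1, by omega, h3⟩
    · exact ⟨n + 1, by omega, le_rfl, rfl⟩

theorem exists_distinct_of_ne {i j k : Fin 4} (hij : i ≠ j) (hik : i ≠ k) (hjk : j ≠ k) :
    ∃ m, Distinct i j k m := by
  obtain ⟨m, h1, h2, h3⟩ : ∃ m, i ≠ m ∧ j ≠ m ∧ k ≠ m := by
    revert i j k
    decide
  exact ⟨m, hij, hik, h1, hjk, h2, h3⟩

theorem exists_distinct {i j : Fin 4} (hij : i ≠ j) : ∃ k m, Distinct i j k m := by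
  obtain ⟨k, h1, h2⟩ : ∃ k, i ≠ k ∧ j ≠ k := by
    revert i j
    decide
  exact ⟨k, exists_distinct_of_ne hij h1 h2⟩

theorem Distinct.swap_right {i j k m : Fin 4} (hd : Distinct i j k m) : Distinct i j m k :=
  ⟨hd.ij, hd.im, hd.ik, hd.jm, hd.jk, hd.km.symm⟩

theorem Distinct.swap_mid {i j k m : Fin 4} (hd : Distinct i j k m) : Distinct i k j m :=
  ⟨hd.ik, hd.ij, hd.im, hd.jk.symm, hd.km, hd.jm⟩

namespace Frame

variable {l : ℕ} {F : Frame G l}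

/-- An inner vertex of a subdivided edge has only its two neighbours along it. -/
theorem At.exists_of_adj {i j : Fin 4} (hij : i ≠ j) {a : ℕ} {x y : V} (hx : F.At i j a x)
    (h0 : 0 < a) (ha : a < F.len i j) (hy : y ∈ F.verts) (hxy : G.Adj x y) :
    ∃ b, (b = a + 1 ∨ a = b + 1) ∧ F.At i j b y := by
  obtain ⟨e, f, n, hef, h1, h2⟩ := exists_at_of_adj (hx.mem_verts hij) hy hxy
  have hmem : y ∈ (F.seg i j).support := by
    by_contra hno
    refine hx.notMem hij hef h0 ha ?_ h1.mem
    rintro (⟨rfl, rfl⟩ | ⟨rfl, rfl⟩)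
    · exact hno h2.mem
    · exact hno (mem_seg_symm.1 h2.mem)
  obtain ⟨b, hb⟩ := exists_at hmem
  exact ⟨b, eq_succ_of_adj hij hx hb hxy, hb⟩

/-- Shortcutting a walk through vertices off the frame gives a jump. -/
theorem exists_jump_of_walk {Z X : Set V} {s t : V} (hs : s ∈ F.verts) (ht : t ∈ F.verts)
    (hst : s ≠ t) (hadj : ¬ G.Adj s t) (hX : ∀ x ∈ X, x ∉ F.verts)
    (hnbr : ∀ x ∈ X, ∀ y ∈ F.verts, G.Adj x y → y = s ∨ y = t ∨ y ∈ Z)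
    (p : G.Walk s t) (hp : ∀ x ∈ p.support, x = s ∨ x = t ∨ x ∈ X) :
    ∃ R : G.Walk s t, F.Jump Z R := by
  obtain ⟨R, hR, hRX, -⟩ := exists_isIndPath_of_walk (X := {x | x = s ∨ x = t ∨ x ∈ X}) p hp
  have key : ∀ x ∈ R.support, x ≠ s → x ≠ t → x ∈ X := fun x hx h1 h2 =>
    ((hRX x hx).resolve_left h1).resolve_left h2
  exact ⟨R, hR, hs, ht, hst, hadj, fun x hx h1 h2 => hX x (key x hx h1 h2),
    fun x hx h1 h2 => hnbr x (key x hx h1 h2)⟩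

/-- The ends of a clean jump are inner vertices of opposite subdivided edges, or they are the
neighbours of some `u i` on `seg i j` and `seg i k` where `seg j k` has length one. -/
theorem Jump.classify {s t : V} {R : G.Walk s t} (hG : InFamily l G) (hR : F.Jump ∅ R) :
    (∃ i j k m a c, Distinct i j k m ∧ F.At i j a s ∧ 0 < a ∧ a < F.len i j ∧ F.At k m c t ∧
        0 < c ∧ c < F.len k m) ∨
      ∃ i j k m, Distinct i j k m ∧ F.At i j 1 s ∧ F.At i k 1 t ∧ F.len j k = 1 := by
  have same : ∀ {i j a c}, i ≠ j → F.At i j a s → F.At i j c t → False := by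
    intro i j a c hij hs ht
    obtain ⟨k, m, hd⟩ := exists_distinct hij
    rcases lt_trichotomy a c with h | rfl | h
    · exact hR.no_same hG hd hs ht h (by simp)
    · exact hR.ne (hs.eq ht)
    · exact hR.symm.no_same hG hd ht hs h (by simp)
  have adjacent : ∀ {i j k a c}, i ≠ j → i ≠ k → j ≠ k → F.At i j a s → F.At i k c t →
      ∃ i j k m, Distinct i j k m ∧ F.At i j 1 s ∧ F.At i k 1 t ∧ F.len j k = 1 := by
    intro i j k a c hij hik hjk hs ht
    obtain ⟨m, hd⟩ := exists_distinct_of_ne hij hik hjk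
    rcases Nat.eq_zero_or_pos a with rfl | ha0
    · obtain rfl := hs.eq (at_left i j)
      exact (same hik (at_left i k) ht).elim
    rcases Nat.eq_zero_or_pos c with rfl | hc0
    · obtain rfl := ht.eq (at_left i k)
      exact (same hij hs (at_left i j)).elim
    rcases hs.le.lt_or_eq with ha | rfl
    · obtain ⟨h1, rfl, rfl⟩ := hR.eq_one_of_adjacent hG hd hs ha0 ha ht hc0
      exact ⟨i, j, k, m, hd, hs, ht, h1⟩
    rcases ht.le.lt_or_eq with hc | rfl
    · obtain ⟨h1, rfl, h2⟩ := hR.symm.eq_one_of_adjacent hG hd.swap_mid ht hc0 hc hs ha0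
      rw [h2] at hs
      exact ⟨i, j, k, m, hd, hs, ht, F.len_symm _ _ ▸ h1⟩
    · obtain rfl := hs.eq (at_right i j)
      obtain rfl := ht.eq (at_right i k)
      exact (same hjk (at_left j k) (at_right j k)).elim
  rcases exists_at_at hR.left_mem hR.right_mem with ⟨i, j, a, c, hij, h1, h2⟩ |
    ⟨i, j, k, a, c, hij, hik, hjk, h1, h2⟩ |
    ⟨i, j, k, m, a, c, hij, hik, him, hjk, hjm, hkm, h1, h2⟩
  · exact (same hij h1 h2).elim
  · exact Or.inr (adjacent hij hik hjk h1 h2)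
  · rcases Nat.eq_zero_or_pos a with rfl | ha0
    · obtain rfl := h1.eq (at_left i j)
      exact Or.inr (adjacent hik.symm hkm him (at_right k i) h2)
    rcases h1.le.lt_or_eq with ha | rfl
    swap
    · obtain rfl := h1.eq (at_right i j)
      exact Or.inr (adjacent hjk.symm hkm hjm (at_right k j) h2)
    rcases Nat.eq_zero_or_pos c with rfl | hc0
    · obtain rfl := h2.eq (at_left k m)
      exact Or.inr (adjacent hij hik hjk h1 (at_right i k))
    rcases h2.le.lt_or_eq with hc | rfl
    swap
    · obtain rfl := h2.eq (at_right k m)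
      exact Or.inr (adjacent hij him hjm h1 (at_right i m))
    exact Or.inl ⟨i, j, k, m, a, c, ⟨hij, hik, him, hjk, hjm, hkm⟩, h1, ha0, ha, h2, hc0, hc⟩

/-- Some inner vertex of a subdivided edge is joined off the frame to a vertex of the frame that
is neither equal nor adjacent to it: otherwise it forms, with its two neighbours in the frame, a
cutset that is a path. -/
theorem exists_off_walk (hl : 4 ≤ l) (hG : InFamily l G) (hcrit : IsVertexCritical 4 G)
    {i j k m : Fin 4} (hd : Distinct i j k m) {a : ℕ} (h0 : 0 < a) (ha : a < F.len i j) {v : V}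
    (hv : F.At i j a v) :
    ∃ t ∈ F.verts, v ≠ t ∧ ¬ G.Adj v t ∧ ∃ p : G.Walk v t,
      ∀ x ∈ p.support, x = v ∨ x = t ∨ x ∉ F.verts := by
  by_contra! hno
  obtain ⟨a, rfl⟩ : ∃ b, a = b + 1 := ⟨a - 1, by omega⟩
  have hs : F.At i j a ((F.seg i j).getVert a) := ⟨by omega, rfl⟩
  have ht : F.At i j (a + 2) ((F.seg i j).getVert (a + 2)) := ⟨ha, rfl⟩
  set s := (F.seg i j).getVert a
  set t := (F.seg i j).getVert (a + 2)
  have hnbr : ∀ y ∈ F.verts, G.Adj v y → y = s ∨ y = t := by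
    intro y hy hvy
    obtain ⟨b, hb, hby⟩ := hv.exists_of_adj hd.ij h0 ha hy hvy
    rcases hb with rfl | hb
    · exact Or.inr (hby.eq ht)
    · obtain rfl : a = b := by omega
      exact Or.inl (hby.eq hs)
  obtain ⟨w, hvw, hws, hwt⟩ := hcrit.exists_adj_ne v s t
  have hw : w ∉ F.verts := fun h => (hnbr w h hvw).elim hws hwt
  have hst : s ≠ t := by
    intro h
    rw [h] at hs
    have := hs.unique ht
    omega
  have hout : ∀ {b z}, F.At i j b z → F.u k ≠ z := by
    rintro b z hb rfl
    rcases u_mem_seg hd.ij hb.mem with h | h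
    exacts [hd.ik h.symm, hd.jk h.symm]
  let K : Set V := {x | ∃ p : G.Walk w x, ∀ y ∈ p.support, y ∉ F.verts}
  have hKoff : ∀ x ∈ F.verts, x ∉ K := fun x hx ⟨p, hp⟩ => hp x p.end_mem_support hx
  refine not_exists_cutset_path (by omega) hG hcrit (adj_of_at hs hv).symm (adj_of_at hv ht) hst
    (hKoff _ (hs.mem_verts hd.ij)) (hKoff _ (hv.mem_verts hd.ij)) (hKoff _ (ht.mem_verts hd.ij))
    ⟨w, Walk.nil, by simpa using hw⟩ ?_ (hKoff _ (u_mem_verts k)) (hout hs) (hout hv) (hout ht)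
  rintro x ⟨p, hp⟩ y hxy
  by_cases hy : y ∈ F.verts
  · by_cases hvy : v = y
    · exact Or.inr (Or.inr (Or.inl hvy.symm))
    by_cases hadj : G.Adj v y
    · rcases hnbr y hy hadj with h | h
      exacts [Or.inr (Or.inl h), Or.inr (Or.inr (Or.inr h))]
    obtain ⟨z, hz, h1, h2, h3⟩ := hno y hy hvy hadj (Walk.cons hvw (p.concat hxy))
    rw [Walk.support_cons, Walk.support_concat, List.mem_cons,
      List.mem_append, List.mem_singleton] at hz
    rcases hz with hz | hz | hz
    exacts [absurd hz h1, absurd h3 (hp z hz), absurd hz h2]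
  · refine Or.inl ⟨p.concat hxy, fun z hz => ?_⟩
    rw [Walk.support_concat, List.mem_append, List.mem_singleton] at hz
    rcases hz with hz | rfl
    exacts [hp z hz, hy]

/-- A shortest walk off the frame from a range of inner vertices of a subdivided edge to a vertex
of the frame is a jump whose inner vertices have, apart from its ends, at most one common neighbour
`z` in the frame. This `z` is adjacent to the first end, and it is itself joined to the other end by
an edge or a jump. -/
theorem exists_minimal_jump (hl : 4 ≤ l) (hG : InFamily l G) (hcrit : IsVertexCritical 4 G)
    {i j k m : Fin 4} (hd : Distinct i j k m) {lo hi : ℕ} (hlo : 0 < lo) (hlohi : lo ≤ hi)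
    (hhi : hi < F.len i j) :
    ∃ a s t, lo ≤ a ∧ a ≤ hi ∧ F.At i j a s ∧ ((∃ R : G.Walk s t, F.Jump ∅ R) ∨
      ∃ z b, (b = a + 1 ∨ a = b + 1) ∧ F.At i j b z ∧ (∃ R : G.Walk s t, F.Jump {z} R) ∧
        (G.Adj z t ∨ ∃ R : G.Walk z t, F.Jump ∅ R)) := by
  classical
  have hex : ∃ n, ∃ (a : ℕ) (s t : V) (p : G.Walk s t), lo ≤ a ∧ a ≤ hi ∧ F.At i j a s ∧
      t ∈ F.verts ∧ s ≠ t ∧ ¬ G.Adj s t ∧ (∀ x ∈ p.support, x = s ∨ x = t ∨ x ∉ F.verts) ∧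
      p.length = n := by
    have hv : F.At i j lo ((F.seg i j).getVert lo) := ⟨by omega, rfl⟩
    obtain ⟨t, ht, h1, h2, p, hp⟩ := exists_off_walk hl hG hcrit hd hlo (by omega) hv
    exact ⟨_, lo, _, t, p, le_rfl, hlohi, hv, ht, h1, h2, hp, rfl⟩
  obtain ⟨a, s, t, p, halo, hahi, hs, ht, hst, hadj, hp, hplen⟩ := Nat.find_spec hex
  obtain ⟨R, hR, hRX, hRlen⟩ :=
    exists_isIndPath_of_walk (X := {x | x = s ∨ x = t ∨ x ∉ F.verts}) p hp
  have hmin : ∀ y ∈ F.verts, s ≠ y → ¬ G.Adj s y → ∀ q : G.Walk s y,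
      (∀ x ∈ q.support, x = s ∨ x = y ∨ x ∉ F.verts) → R.length ≤ q.length := by
    intro y hy h1 h2 q hq
    have := Nat.find_min' hex ⟨a, s, y, q, halo, hahi, hs, hy, h1, h2, hq, rfl⟩
    omega
  refine ⟨a, s, t, halo, hahi, hs, ?_⟩
  obtain ⟨a, rfl⟩ : ∃ b, a = b + 1 := ⟨a - 1, by omega⟩
  have hsv := hs.mem_verts hd.ij
  have hoff : ∀ n, 0 < n → n < R.length → R.getVert n ∉ F.verts := by
    intro n h1 h2
    refine ((hRX _ (R.getVert_mem_support n)).resolve_left fun h => ?_).resolve_left fun h => ?_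
    · have := hR.1.getVert_injOn (show n ≤ R.length from h2.le)
        (show 0 ≤ R.length from Nat.zero_le _) (h.trans R.getVert_zero.symm)
      omega
    · have := hR.1.getVert_injOn (show n ≤ R.length from h2.le)
        (show R.length ≤ R.length from le_rfl) (h.trans R.getVert_length.symm)
      omega
  have hnots : ∀ n, 2 ≤ n → n < R.length → ¬ G.Adj (R.getVert n) s := by
    intro n h1 h2 h
    have := hR.eq_succ_or h2.le (Nat.zero_le _) (by rwa [R.getVert_zero])
    omega
  have hnott : ∀ n, n + 2 ≤ R.length → ¬ G.Adj (R.getVert n) t := by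
    intro n h1 h
    have := hR.eq_succ_or (m := n) (n := R.length) (by omega) le_rfl (by rwa [R.getVert_length])
    omega
  -- the attachments are neighbours of `s`, and the vertices attached are not ends of the interior
  have hatt : ∀ n, 0 < n → n < R.length → ∀ y ∈ F.verts, G.Adj (R.getVert n) y → y ≠ s → y ≠ t →
      2 ≤ n ∧ n + 2 ≤ R.length ∧ (F.At i j a y ∨ F.At i j (a + 2) y) := by
    intro n h1 h2 y hy hny hys hyt
    have hn2 : 2 ≤ n := by
      by_contra hn
      obtain rfl : n = 1 := by omega
      have h3 := R.adj_getVert_succ (i := 0) (by omega)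
      rw [R.getVert_zero] at h3
      exact hys (eq_of_adj_of_adj hl hG (hoff 1 h1 h2) hy hsv hny h3.symm)
    have hnl : n + 2 ≤ R.length := by
      by_contra hn
      have h3 := R.adj_getVert_succ h2
      obtain h4 : n + 1 = R.length := by omega
      rw [h4, R.getVert_length] at h3
      exact hyt (eq_of_adj_of_adj hl hG (hoff n h1 h2) hy ht hny h3)
    -- otherwise the part of `R` up to this vertex leads to `y` on a shorter way
    have hsy : G.Adj s y := by
      by_contra hsy
      have h3 := hmin y hy hys.symm hsy ((R.take n).concat hny) fun x hx => by
        rw [Walk.support_concat, List.mem_append, List.mem_singleton] at hx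
        rcases hx with hx | rfl
        · obtain ⟨b, rfl, hb⟩ := Walk.mem_support_iff_exists_getVert.1 hx
          rw [Walk.take_length] at hb
          rw [Walk.take_getVert]
          rcases Nat.eq_zero_or_pos (min n b) with h | h
          · left
            rw [h, R.getVert_zero]
          · exact Or.inr (Or.inr (hoff _ h (by omega)))
        · exact Or.inr (Or.inl rfl)
      rw [Walk.length_concat, Walk.take_length] at h3
      omega
    obtain ⟨b, hb, hby⟩ := hs.exists_of_adj hd.ij (by omega) (by omega) hy hsy
    refine ⟨hn2, hnl, ?_⟩
    rcases hb with rfl | hb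
    · exact Or.inr hby
    · obtain rfl : a = b := by omega
      exact Or.inl hby
  -- the two neighbours of `s` cannot both occur as attachments
  have hboth : ∀ {n n' y y'}, 2 ≤ n → n + 2 ≤ R.length → 2 ≤ n' → n' + 2 ≤ R.length →
      G.Adj (R.getVert n) y → G.Adj (R.getVert n') y' → F.At i j a y → F.At i j (a + 2) y' →
      False := by
    intro n n' y y' h1 h2 h1' h2' hny hny' hy hy'
    obtain ⟨W, hW⟩ : ∃ W : G.Walk (R.getVert n) (R.getVert n'), ∀ x ∈ W.support,
        ∃ b, 2 ≤ b ∧ b + 2 ≤ R.length ∧ R.getVert b = x := by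
      rcases le_total n n' with h | h
      · obtain ⟨W, hW⟩ := exists_walk_getVert R h (by omega)
        refine ⟨W, fun x hx => ?_⟩
        obtain ⟨b, e1, e2, e3⟩ := hW x hx
        exact ⟨b, by omega, by omega, e3⟩
      · obtain ⟨W, hW⟩ := exists_walk_getVert R h (by omega)
        refine ⟨W.reverse, fun x hx => ?_⟩
        obtain ⟨b, e1, e2, e3⟩ := hW x (by simpa using hx)
        exact ⟨b, by omega, by omega, e3⟩
    obtain ⟨R', hR'⟩ := exists_jump_of_walk (F := F) (Z := ∅)
      (X := {x | ∃ b, 2 ≤ b ∧ b + 2 ≤ R.length ∧ R.getVert b = x}) (hy.mem_verts hd.ij)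
      (hy'.mem_verts hd.ij)
      (by
        rintro rfl
        have := hy.unique hy'
        omega)
      (fun h => by
        have := eq_succ_of_adj hd.ij hy hy' h
        omega)
      (by
        rintro _ ⟨b, e1, e2, rfl⟩
        exact hoff b (by omega) (by omega))
      (by
        rintro _ ⟨b, e1, e2, rfl⟩ x hx hbx
        have := (hatt b (by omega) (by omega) x hx hbx
          (fun h => hnots b e1 (by omega) (h ▸ hbx)) (fun h => hnott b e2 (h ▸ hbx))).2.2
        rcases this with h | h
        exacts [Or.inl (h.eq hy), Or.inr (Or.inl (h.eq hy'))])
      (Walk.cons hny.symm (W.concat hny'))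
      (by
        intro x hx
        rw [Walk.support_cons, Walk.support_concat, List.mem_cons,
          List.mem_append, List.mem_singleton] at hx
        rcases hx with hx | hx | hx
        exacts [Or.inl hx, Or.inr (Or.inr (hW x hx)), Or.inr (Or.inl hx)])
    exact hR'.no_same hG hd hy hy' (by omega) (by simp)
  have hinner : ∀ x ∈ R.support, x ≠ s → x ≠ t →
      ∃ n, 0 < n ∧ n < R.length ∧ R.getVert n = x := by
    intro x hx h1 h2
    obtain ⟨n, rfl, hn⟩ := Walk.mem_support_iff_exists_getVert.1 hx
    refine ⟨n, Nat.pos_of_ne_zero ?_, lt_of_le_of_ne hn ?_, rfl⟩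
    · rintro rfl
      exact h1 R.getVert_zero
    · rintro rfl
      exact h2 R.getVert_length
  have hoff' : ∀ x ∈ R.support, x ≠ s → x ≠ t → x ∉ F.verts := by
    intro x hx h1 h2
    obtain ⟨n, e1, e2, rfl⟩ := hinner x hx h1 h2
    exact hoff n e1 e2
  by_cases hclean : ∀ n, 0 < n → n < R.length → ∀ y ∈ F.verts, G.Adj (R.getVert n) y →
      y = s ∨ y = t
  · refine Or.inl ⟨R, hR, hsv, ht, hst, hadj, hoff', fun x hx h1 h2 y hy hxy => ?_⟩
    obtain ⟨n, e1, e2, rfl⟩ := hinner x hx h1 h2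
    exact (hclean n e1 e2 y hy hxy).imp_right Or.inl
  push Not at hclean
  obtain ⟨n, hn0, hnl, z, hz, hnz, hzs, hzt⟩ := hclean
  obtain ⟨hn2, hnl2, hzat⟩ := hatt n hn0 hnl z hz hnz hzs hzt
  have huniq : ∀ n', 0 < n' → n' < R.length → ∀ y ∈ F.verts, G.Adj (R.getVert n') y →
      y = s ∨ y = t ∨ y = z := by
    intro n' h1 h2 y hy hny
    by_contra! hne
    obtain ⟨e1, e2, hyat⟩ := hatt n' h1 h2 y hy hny hne.1 hne.2.1
    rcases hyat with hyat | hyat <;> rcases hzat with hzat | hzat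
    · exact hne.2.2 (hyat.eq hzat)
    · exact hboth e1 e2 hn2 hnl2 hny hnz hyat hzat
    · exact hboth hn2 hnl2 e1 e2 hnz hny hzat hyat
    · exact hne.2.2 (hyat.eq hzat)
  have hjump : ∃ R : G.Walk s t, F.Jump {z} R := by
    refine ⟨R, hR, hsv, ht, hst, hadj, hoff', fun x hx h1 h2 y hy hxy => ?_⟩
    obtain ⟨n', e1, e2, rfl⟩ := hinner x hx h1 h2
    exact huniq n' e1 e2 y hy hxy
  -- the part of `R` from the attachment of `z` on is not adjacent to `s`
  have hlast : G.Adj z t ∨ ∃ R : G.Walk z t, F.Jump ∅ R := by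
    by_cases hzt' : G.Adj z t
    · exact Or.inl hzt'
    obtain ⟨W, hW⟩ := exists_walk_getVert R (m := n) (n := R.length) (by omega) le_rfl
    refine Or.inr (exists_jump_of_walk (F := F) (Z := ∅)
      (X := {x | ∃ b, n ≤ b ∧ b < R.length ∧ R.getVert b = x}) hz ht hzt hzt' ?_ ?_
      (Walk.cons hnz.symm (W.copy rfl R.getVert_length)) ?_)
    · rintro _ ⟨b, e1, e2, rfl⟩
      exact hoff b (by omega) e2
    · rintro _ ⟨b, e1, e2, rfl⟩ y hy hby
      rcases huniq b (by omega) e2 y hy hby with h | h | h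
      · exact absurd (h ▸ hby) (hnots b (by omega) e2)
      · exact Or.inr (Or.inl h)
      · exact Or.inl h
    · intro x hx
      rw [Walk.support_cons, Walk.support_copy, List.mem_cons] at hx
      rcases hx with hx | hx
      · exact Or.inl hx
      · obtain ⟨b, e1, e2, rfl⟩ := hW x hx
        rcases e2.lt_or_eq with h | rfl
        · exact Or.inr (Or.inr ⟨b, e1, h, rfl⟩)
        · exact Or.inr (Or.inl R.getVert_length)
  right
  rcases hzat with hzat | hzat
  · exact ⟨z, a, Or.inr rfl, hzat, hjump, hlast⟩
  · exact ⟨z, a + 2, Or.inl rfl, hzat, hjump, hlast⟩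

end Frame

/-! ### Frames with two lengths below `l` -/

theorem Distinct.eq_or {i j k m : Fin 4} (hd : Distinct i j k m) (x : Fin 4) :
    x = i ∨ x = j ∨ x = k ∨ x = m := by
  obtain ⟨h1, h2, h3, h4, h5, h6⟩ := hd
  omega

theorem Distinct.len_eq_or {l : ℕ} {i j k m : Fin 4} (hd : Distinct i j k m) (F : Frame G l)
    {e f : Fin 4} (hef : e ≠ f) :
    F.len e f = F.len i j ∨ F.len e f = F.len i k ∨ F.len e f = F.len i m := by
  obtain ⟨e1, e2, e3, e4, e5, e6, e7, e8, e9, e10⟩ := hd.lens F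
  rcases hd.eq_or e with rfl | rfl | rfl | rfl <;> rcases hd.eq_or f with rfl | rfl | rfl | rfl <;>
    first
    | exact absurd rfl hef
    | simp only [e1, e2, e3, e5, e6, e7, e8, e9, e10, true_or, or_true]

namespace Frame

variable {l : ℕ} {F : Frame G l}

/-- Reading a position in another orientation of the subdivided edge. -/
theorem At.reorient {i j i' j' : Fin 4} (h : (i' = i ∧ j' = j) ∨ (i' = j ∧ j' = i)) {a : ℕ} {x : V}
    (hx : F.At i' j' a x) (h0 : 0 < a) (ha : a < F.len i' j') :
    ∃ b, F.At i j b x ∧ 0 < b ∧ b < F.len i j := by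
  rcases h with ⟨rfl, rfl⟩ | ⟨rfl, rfl⟩
  · exact ⟨a, hx, h0, ha⟩
  · refine ⟨_, hx.symm, by omega, ?_⟩
    rw [F.len_symm i' j']
    omega

/-- The cases of `Jump.classify` for a jump that starts on a given subdivided edge. -/
theorem Jump.classify_of_mem {s t : V} {R : G.Walk s t} (hG : InFamily l G) (hR : F.Jump ∅ R)
    {i j k m : Fin 4} (hd : Distinct i j k m) (hs : s ∈ (F.seg i j).support) :
    (∃ a c, F.At i j a s ∧ 0 < a ∧ a < F.len i j ∧ F.At k m c t ∧ 0 < c ∧ c < F.len k m) ∨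
      ∃ i' j' k' m', Distinct i' j' k' m' ∧ F.At i' j' 1 s ∧ F.At i' k' 1 t ∧
        F.len j' k' = 1 := by
  refine (hR.classify hG).imp_left ?_
  rintro ⟨i', j', k', m', a, c, hd', h1, h2, h3, h4, h5, h6⟩
  have hij : (i' = i ∧ j' = j) ∨ (i' = j ∧ j' = i) := by
    by_contra h
    exact h1.notMem hd'.ij hd.ij h2 h3 h hs
  have hkm : (k' = k ∧ m' = m) ∨ (k' = m ∧ m' = k) := by
    have h1 := hd'.ik
    have h2 := hd'.im
    have h3 := hd'.jk
    have h4 := hd'.jm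
    have h5 := hd'.km
    rcases hd.eq_or k' with rfl | rfl | rfl | rfl <;>
      rcases hd.eq_or m' with rfl | rfl | rfl | rfl <;> grind
  obtain ⟨a', ha', ha0, hal⟩ := h1.reorient hij h2 h3
  obtain ⟨c', hc', hc0, hcl⟩ := h4.reorient hkm h5 h6
  exact ⟨a', c', ha', ha0, hal, hc', hc0, hcl⟩

/-- The neighbour `z` of a minimal jump, if an inner vertex of its subdivided edge, is not adjacent
to the second end. -/
theorem Jump.not_adj_of_at {s t z : V} {R : G.Walk s t} (hG : InFamily l G) (hR : F.Jump {z} R)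
    {i j k m : Fin 4} (hd : Distinct i j k m) {a b : ℕ} (hs : F.At i j a s) (hz : F.At i j b z)
    (hab : b = a + 1 ∨ a = b + 1) (hb0 : 0 < b) (hb : b < F.len i j) : ¬ G.Adj z t := by
  intro hzt
  obtain ⟨c, hc, ht⟩ := hz.exists_of_adj hd.ij hb0 hb hR.right_mem hzt
  have hac : a ≠ c := by
    rintro rfl
    exact hR.ne (hs.eq ht)
  rcases hac.lt_or_gt with h | h
  · refine hR.no_same hG hd hs ht h ?_
    rintro _ rfl
    exact ⟨b, by omega, by omega, hz⟩
  · refine hR.symm.no_same hG hd ht hs h ?_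
    rintro _ rfl
    exact ⟨b, by omega, by omega, hz⟩

/-- The neighbour `z` of a minimal jump, if a branch vertex, is not adjacent to the second end. -/
theorem Jump.not_adj_of_eq_u {s t : V} {R : G.Walk s t} (hG : InFamily l G) {i j : Fin 4}
    (hR : F.Jump {F.u i} R) (hij : i ≠ j) (hs : F.At i j 1 s)
    (hlen : ∀ e f, e ≠ f → 2 ≤ F.len e f) : ¬ G.Adj (F.u i) t := by
  intro hadj
  obtain ⟨e, f, n, hef, h1, h2⟩ := exists_at_of_adj (u_mem_verts i) hR.right_mem hadj
  rcases u_mem_seg hef h1.mem with rfl | rfl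
  · obtain rfl := h1.left_iff
    by_cases hjf : j = f
    · subst hjf
      exact hR.ne (hs.eq h2)
    · obtain ⟨m, hd⟩ := exists_distinct_of_ne hij hef hjf
      exact hR.no_star hG hd hs h2 (hlen _ _ hjf)
  · have e1 := h1.right_iff
    have e2 := h2.le
    omega

/-- With two lengths below `l` all lengths are at least `2`, there are no clean jumps, and the
minimal jump from the interior of the remaining subdivided edge is impossible. -/
theorem false_of_len_lt (hl : 4 ≤ l) (hG : InFamily l G) (hcrit : IsVertexCritical 4 G)
    (F : Frame G l) {i j k m : Fin 4} (hd : Distinct i j k m) (hik : F.len i k < l)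
    (him : F.len i m < l) : False := by
  have hlens := (hd.lens F).2.2.2.1
  have hij := len_le (F := F) hG hd.ij
  have hlen : ∀ e f, e ≠ f → 2 ≤ F.len e f := by
    intro e f hef
    rcases hd.len_eq_or F hef with h | h | h <;> omega
  have hclean : ∀ {b x y}, F.At i j b x → ∀ R : G.Walk x y, ¬ F.Jump ∅ R := by
    intro b x y hx R hR
    rcases hR.classify_of_mem hG hd hx.mem with ⟨a, c, h1, h2, h3, h4, h5, h6⟩ |
      ⟨i', j', k', m', hd', -, -, h⟩
    · exact hR.no_opposite hG hd h1 h2 h3 h4 h5 h6 (hlen _ _ hd.ik) hik (hlen _ _ hd.im) him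
    · have := hlen _ _ hd'.jk
      omega
  obtain ⟨a, s, t, h1, h2, hs, ⟨R, hR⟩ | ⟨z, b, hab, hz, ⟨R, hR⟩, h⟩⟩ :=
    exists_minimal_jump (F := F) hl hG hcrit hd (lo := 1) (hi := F.len i j - 1) one_pos
      (by omega) (by omega)
  · exact hclean hs R hR
  rcases h with hzt | ⟨R', hR'⟩
  swap
  · exact hclean hz R' hR'
  rcases Nat.eq_zero_or_pos b with rfl | hb0
  · obtain rfl := hz.eq (at_left i j)
    obtain rfl : a = 1 := by omega
    exact hR.not_adj_of_eq_u hG hd.ij hs hlen hzt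
  rcases hz.le.lt_or_eq with hb | rfl
  · exact hR.not_adj_of_at hG hd hs hz hab hb0 hb hzt
  · obtain rfl := hz.eq (at_right i j)
    exact hR.not_adj_of_eq_u hG hd.ij.symm (hs.symm' (b := 1) (by omega)) hlen hzt

end Frame

/-! ### Frames with two lengths equal to `l` -/

theorem eq_of_mem_append {a b c : V} {p : G.Walk a b} {q : G.Walk b c}
    (h : (p.append q).IsPath) {x : V} (hp : x ∈ p.support) (hq : x ∈ q.support) : x = b := by
  by_contra hne
  have hnd := h.support_nodup
  rw [Walk.support_append, List.nodup_append'] at hnd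
  rw [Walk.mem_support_iff] at hq
  exact hnd.2.2 hp (hq.resolve_left hne)

namespace Frame

variable {l : ℕ} {F : Frame G l}

theorem exists_walk_split {i j : Fin 4} {a : ℕ} {x : V} (h : F.At i j a x) :
    ∃ (A : G.Walk (F.u i) x) (B : G.Walk x (F.u j)), A.append B = F.seg i j ∧ A.length = a ∧
      a + B.length = F.len i j := by
  obtain ⟨hle, rfl⟩ := h
  have hlen : ((F.seg i j).take a).length = a := by
    rw [Walk.take_length]
    exact min_eq_left hle
  refine ⟨(F.seg i j).take a, (F.seg i j).drop a, (F.seg i j).append_take_drop_eq a, hlen, ?_⟩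
  have := congrArg Walk.length ((F.seg i j).append_take_drop_eq a)
  rwa [Walk.length_append, hlen] at this

/-- Every edge of the frame lies on one of the six subdivided edges in a given orientation. -/
theorem mem_edges_of_adj {i j k m : Fin 4} (hd : Distinct i j k m) {x y : V} (hx : x ∈ F.verts)
    (hy : y ∈ F.verts) (hxy : G.Adj x y) :
    s(x, y) ∈ (F.seg i j).edges ∨ s(x, y) ∈ (F.seg k m).edges ∨ s(x, y) ∈ (F.seg i m).edges ∨
      s(x, y) ∈ (F.seg m j).edges ∨ s(x, y) ∈ (F.seg i k).edges ∨ s(x, y) ∈ (F.seg j k).edges := by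
  obtain ⟨e, f, n, hef, h1, h2⟩ := exists_at_of_adj hx hy hxy
  have he : s(x, y) ∈ (F.seg e f).edges := by
    rw [Walk.mk_mem_edges_iff_exists]
    exact ⟨n, h2.le, by rw [h1.2, h2.2]⟩
  have hrev : ∀ {e f}, s(x, y) ∈ (F.seg e f).edges → s(x, y) ∈ (F.seg f e).edges := by
    intro e f h
    rw [F.seg_symm e f, Walk.edges_reverse, List.mem_reverse]
    exact h
  have he' := hrev he
  rcases hd.eq_or e with rfl | rfl | rfl | rfl <;> rcases hd.eq_or f with rfl | rfl | rfl | rfl <;>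
    first
    | exact absurd rfl hef
    | simp only [he, he', true_or, or_true]

/-- A jump `R` between inner vertices `s` and `t` of the opposite subdivided edges `seg i j` and
`seg k m` yields the `K₄`-subdivision with branch vertices `u i`, `u m`, `s` and `t` that is made up
of `R` and all subdivided edges but `seg j k`. -/
theorem Jump.exists_k4Subdivision {s t : V} {R : G.Walk s t} (hR : F.Jump ∅ R) {i j k m : Fin 4}
    (hd : Distinct i j k m) {a b c d : ℕ} (hs : F.At i j a s) (ha0 : 0 < a) (hb0 : 0 < b)
    (hb : F.len i j = a + b) (ht : F.At k m c t) (hc0 : 0 < c) (hd0 : 0 < d)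
    (hdd : F.len k m = c + d) :
    ∃ H : K4Subdivision G, H.P₁.length = F.len i m ∧ H.P₂.length = R.length ∧
      H.Q₁.length = F.len m j + b ∧ H.Q₂.length = F.len i k + c ∧ H.L₁.length = a ∧
      H.L₂.length = d ∧
      (∀ x, (x ∈ H.P₁.support ∨ x ∈ H.L₁.support ∨ x ∈ H.Q₂.support ∨ x ∈ H.Q₁.support ∨
        x ∈ H.L₂.support ∨ x ∈ H.P₂.support) →
        x ∈ R.support ∨ x ∈ (F.seg i j).support ∨ x ∈ (F.seg k m).support ∨
        x ∈ (F.seg i m).support ∨ x ∈ (F.seg m j).support ∨ x ∈ (F.seg i k).support) ∧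
      ∀ e, (e ∈ R.edges ∨ e ∈ (F.seg i j).edges ∨ e ∈ (F.seg k m).edges ∨
        e ∈ (F.seg i m).edges ∨ e ∈ (F.seg m j).edges ∨ e ∈ (F.seg i k).edges) →
        ∃ n n', n ≠ n' ∧ e ∈ (H.arris n n').edges := by
  obtain ⟨A, B, hAB, hA, hB⟩ := exists_walk_split hs
  obtain ⟨C, D, hCD, hC, hD⟩ := exists_walk_split ht
  have pAB : (A.append B).IsPath := hAB ▸ F.isPath i j
  have pCD : (C.append D).IsPath := hCD ▸ F.isPath k m
  have sA : ∀ {x}, x ∈ A.support → x ∈ (F.seg i j).support := fun h =>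
    hAB ▸ (Walk.mem_support_append_iff _ _).2 (Or.inl h)
  have sB : ∀ {x}, x ∈ B.support → x ∈ (F.seg i j).support := fun h =>
    hAB ▸ (Walk.mem_support_append_iff _ _).2 (Or.inr h)
  have sC : ∀ {x}, x ∈ C.support → x ∈ (F.seg k m).support := fun h =>
    hCD ▸ (Walk.mem_support_append_iff _ _).2 (Or.inl h)
  have sD : ∀ {x}, x ∈ D.support → x ∈ (F.seg k m).support := fun h =>
    hCD ▸ (Walk.mem_support_append_iff _ _).2 (Or.inr h)
  have ends : ∀ {i j k m : Fin 4} {a : ℕ} {s : V}, Distinct i j k m → F.At i j a s → 0 < a →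
      a < F.len i j → s ∉ (F.seg i m).support ∧ s ∉ (F.seg i k).support ∧
        s ∉ (F.seg m j).support ∧ s ∉ (F.seg k m).support ∧ s ∉ (F.seg j k).support ∧
        s ≠ F.u i ∧ s ≠ F.u j := by
    intro i j k m a s hd hs h0 h
    have key : ∀ n n', n ≠ n' → ¬ ((i = n ∧ j = n') ∨ (i = n' ∧ j = n)) →
        s ∉ (F.seg n n').support := fun n n' hnn hne => hs.notMem hd.ij hnn h0 h hne
    refine ⟨key _ _ hd.im ?_, key _ _ hd.ik ?_, key _ _ hd.jm.symm ?_, key _ _ hd.km ?_,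
      key _ _ hd.jk ?_, ?_, ?_⟩
    · rintro (h | h)
      exacts [hd.jm h.2, hd.im h.1]
    · rintro (h | h)
      exacts [hd.jk h.2, hd.ik h.1]
    · rintro (h | h)
      exacts [hd.im h.1, hd.ij h.1]
    · rintro (h | h)
      exacts [hd.ik h.1, hd.im h.1]
    · rintro (h | h)
      exacts [hd.ij h.1, hd.ik h.1]
    · rintro rfl
      exact key _ _ hd.ik (by rintro (h | h); exacts [hd.jk h.2, hd.ik h.1])
        (Walk.start_mem_support _)
    · rintro rfl
      exact key _ _ hd.jk (by rintro (h | h); exacts [hd.ij h.1, hd.ik h.1])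
        (Walk.start_mem_support _)
  obtain ⟨s1, s2, s3, s4, -, s6, s7⟩ := ends hd hs (by omega) (by omega)
  -- the position of `t` relative to the relabelling `k m i j`
  obtain ⟨t1, t2, t3, t4, -, t6, t7⟩ := ends (i := k) (j := m) (k := i) (m := j)
    ⟨hd.km, hd.ik.symm, hd.jk.symm, hd.im.symm, hd.jm.symm, hd.ij⟩ ht (by omega) (by omega)
  have t5 : t ∉ (F.seg i m).support := fun h => by
    refine ht.notMem hd.km hd.im hc0 (by omega) ?_ h
    rintro (h | h)
    exacts [hd.ik h.1.symm, hd.km h.1]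
  have iB : F.u i ∉ B.support := fun h => s6 (eq_of_mem_append pAB A.start_mem_support h).symm
  have jA : F.u j ∉ A.support := fun h => s7 (eq_of_mem_append pAB h B.end_mem_support).symm
  have kD : F.u k ∉ D.support := fun h => t6 (eq_of_mem_append pCD C.start_mem_support h).symm
  have mC : F.u m ∉ C.support := fun h => t7 (eq_of_mem_append pCD h D.end_mem_support).symm
  have offR : ∀ {x}, x ∈ R.support → x ∈ F.verts → x = s ∨ x = t := by
    intro x hx hxv
    by_contra! hne
    exact hR.off x hx hne.1 hne.2 hxv
  have disjoint : ∀ {x}, x ∈ (F.seg i j).support → x ∉ (F.seg k m).support :=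
    F.disj hd.ij hd.ik hd.im hd.jk hd.jm hd.km
  have eQ₁ : ∀ {e}, e ∈ (F.seg m j).edges ∨ e ∈ B.edges →
      e ∈ ((F.seg m j).append B.reverse).edges := fun h => by simpa using h
  have eQ₂ : ∀ {e}, e ∈ (F.seg i k).edges ∨ e ∈ C.edges → e ∈ ((F.seg i k).append C).edges :=
    fun h => by simpa using h
  have eL₂ : ∀ {e}, e ∈ D.edges → e ∈ D.reverse.edges := fun h => by simpa using h
  refine ⟨
    { u₁ := F.u i
      u₂ := F.u m
      u₃ := s
      u₄ := t
      P₁ := F.seg i m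
      P₂ := R
      Q₁ := (F.seg m j).append B.reverse
      Q₂ := (F.seg i k).append C
      L₁ := A
      L₂ := D.reverse
      nodup := by
        have h1 : F.u i ≠ F.u m := fun h => hd.im (F.inj h)
        have h2 : F.u i ≠ t := fun h => t5 (h ▸ Walk.start_mem_support _)
        have h3 : F.u m ≠ s := fun h => s1 (h ▸ Walk.end_mem_support _)
        simp [h1, h2, h3, s6.symm, t7.symm, hR.ne]
      isPath_P₁ := F.isPath i m
      isPath_P₂ := hR.ind.1
      isPath_Q₁ := isPath_append (F.isPath m j) pAB.of_append_right.reverse fun x h h' =>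
        F.meet hd.jm hd.ij.symm hd.im.symm (mem_seg_symm.1 h)
          (mem_seg_symm.1 (sB (by simpa using h')))
      isPath_Q₂ := isPath_append (F.isPath i k) pCD.of_append_left fun x h h' =>
        F.meet hd.ik.symm hd.km hd.im (mem_seg_symm.1 h) (sC h')
      isPath_L₁ := pAB.of_append_left
      isPath_L₂ := pCD.of_append_right.reverse
      disj_P := by
        rintro x h h'
        rcases offR h' ⟨i, m, hd.im, h⟩ with rfl | rfl
        exacts [s1 h, t5 h]
      disj_Q := by
        intro x h h'
        rw [Walk.mem_support_append_iff, Walk.support_reverse, List.mem_reverse] at h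
        rw [Walk.mem_support_append_iff] at h'
        rcases h with h | h <;> rcases h' with h' | h'
        · exact F.disj hd.jm.symm hd.im.symm hd.km.symm hd.ij.symm hd.jk hd.ik h h'
        · exact mC (F.meet hd.jm.symm hd.km.symm hd.jk h (mem_seg_symm.1 (sC h')) ▸ h')
        · exact iB (F.meet hd.ij hd.ik hd.jk (sB h) h' ▸ h)
        · exact disjoint (sB h) (sC h')
      disj_L := by
        intro x h h'
        exact disjoint (sA h) (sD (by simpa using h'))
      meet_P₁_Q₂ := by
        intro x h h'
        rcases (Walk.mem_support_append_iff _ _).1 h' with h' | h'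
        · exact F.meet hd.im hd.ik hd.km.symm h h'
        · exact absurd (F.meet hd.im.symm hd.km.symm hd.ik (mem_seg_symm.1 h)
            (mem_seg_symm.1 (sC h')) ▸ h') mC
      meet_P₁_L₁ := fun x h h' => F.meet hd.im hd.ij hd.jm.symm h (sA h')
      meet_Q₂_L₁ := by
        intro x h h'
        rcases (Walk.mem_support_append_iff _ _).1 h with h | h
        · exact F.meet hd.ik hd.ij hd.jk.symm h (sA h')
        · exact absurd (sC h) (disjoint (sA h'))
      meet_P₁_Q₁ := by
        intro x h h'
        rw [Walk.mem_support_append_iff, Walk.support_reverse, List.mem_reverse] at h'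
        rcases h' with h' | h'
        · exact F.meet hd.im.symm hd.jm.symm hd.ij (mem_seg_symm.1 h) h'
        · exact absurd (F.meet hd.im hd.ij hd.jm.symm h (sB h') ▸ h') iB
      meet_P₁_L₂ := fun x h h' => F.meet hd.im.symm hd.km.symm hd.ik (mem_seg_symm.1 h)
        (mem_seg_symm.1 (sD (by simpa using h')))
      meet_Q₁_L₂ := by
        intro x h h'
        rw [Walk.mem_support_append_iff, Walk.support_reverse, List.mem_reverse] at h
        replace h' := sD (by simpa using h')
        rcases h with h | h
        · exact F.meet hd.jm.symm hd.km.symm hd.jk h (mem_seg_symm.1 h')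
        · exact absurd h' (disjoint (sB h))
      meet_P₂_Q₁ := by
        intro x h h'
        rw [Walk.mem_support_append_iff, Walk.support_reverse, List.mem_reverse] at h'
        have hv : x ∈ F.verts :=
          h'.elim (fun h => ⟨m, j, hd.jm.symm, h⟩) fun h => ⟨i, j, hd.ij, sB h⟩
        refine (offR h hv).resolve_right ?_
        rintro rfl
        rcases h' with h' | h'
        exacts [t3 (mem_seg_symm.1 h'), disjoint (sB h') (sC C.end_mem_support)]
      meet_P₂_L₁ := by
        intro x h h'
        refine (offR h ⟨i, j, hd.ij, sA h'⟩).resolve_right ?_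
        rintro rfl
        exact disjoint (sA h') (sC C.end_mem_support)
      meet_Q₁_L₁ := by
        intro x h h'
        rw [Walk.mem_support_append_iff, Walk.support_reverse, List.mem_reverse] at h
        rcases h with h | h
        · exact absurd (F.meet hd.jm hd.ij.symm hd.im.symm (mem_seg_symm.1 h)
            (mem_seg_symm.1 (sA h')) ▸ h') jA
        · exact eq_of_mem_append pAB h' h
      meet_P₂_Q₂ := by
        intro x h h'
        rw [Walk.mem_support_append_iff] at h'
        have hv : x ∈ F.verts :=
          h'.elim (fun h => ⟨i, k, hd.ik, h⟩) fun h => ⟨k, m, hd.km, sC h⟩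
        refine (offR h hv).resolve_left ?_
        rintro rfl
        exact h'.elim s2 fun h => s4 (sC h)
      meet_P₂_L₂ := by
        intro x h h'
        replace h' := sD (by simpa using h')
        refine (offR h ⟨k, m, hd.km, h'⟩).resolve_left ?_
        rintro rfl
        exact s4 h'
      meet_Q₂_L₂ := by
        intro x h h'
        replace h' : x ∈ D.support := by simpa using h'
        rcases (Walk.mem_support_append_iff _ _).1 h with h | h
        · exact absurd (F.meet hd.ik.symm hd.km hd.im (mem_seg_symm.1 h) (sD h') ▸ h') kD
        · exact eq_of_mem_append pCD h h' },
    rfl, rfl, ?_, ?_, hA, ?_, ?_, ?_⟩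
  · rw [Walk.length_append, Walk.length_reverse]
    change F.len m j + B.length = _
    omega
  · rw [Walk.length_append, hC]
    rfl
  · rw [Walk.length_reverse]
    omega
  · rintro x (h | h | h | h | h | h)
    · simp only [h, true_or, or_true]
    · simp only [sA h, true_or, or_true]
    · rcases (Walk.mem_support_append_iff _ _).1 h with h | h
      · simp only [h, or_true]
      · simp only [sC h, true_or, or_true]
    · rcases (Walk.mem_support_append_iff _ _).1 h with h | h
      · simp only [h, true_or, or_true]
      · simp only [sB (K4Subdivision.mem_support_of_mem_reverse h), true_or, or_true]
    · simp only [sD (K4Subdivision.mem_support_of_mem_reverse h), true_or, or_true]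
    · exact Or.inl h
  · rintro e (h | h | h | h | h | h)
    · exact ⟨2, 3, by decide, h⟩
    · rw [← hAB, Walk.edges_append, List.mem_append] at h
      exact h.elim (fun h => ⟨0, 2, by decide, h⟩) fun h => ⟨1, 2, by decide, eQ₁ (Or.inr h)⟩
    · rw [← hCD, Walk.edges_append, List.mem_append] at h
      exact h.elim (fun h => ⟨0, 3, by decide, eQ₂ (Or.inr h)⟩) fun h => ⟨1, 3, by decide, eL₂ h⟩
    · exact ⟨0, 1, by decide, h⟩
    · exact ⟨1, 2, by decide, eQ₁ (Or.inl h)⟩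
    · exact ⟨0, 3, by decide, eQ₂ (Or.inl h)⟩

/-- In a frame with lengths `l`, `l` and `1`, a jump of length `l` between inner vertices of
opposite subdivided edges of length `l` yields another frame with two lengths below `l`. -/
theorem Jump.false_of_opposite (hl : 4 ≤ l) (hG : InFamily l G) (hcrit : IsVertexCritical 4 G)
    {s t : V} {R : G.Walk s t} (hR : F.Jump ∅ R) (hRl : R.length = l) {i j k m : Fin 4}
    (hd : Distinct i j k m) (hij : F.len i j = l) (him : F.len i m = l) (hik : F.len i k = 1)
    {a c : ℕ} (hs : F.At i j a s) (ha2 : 2 ≤ a) (ht : F.At k m c t) (hc0 : 0 < c)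
    (hac : a + c = l) : False := by
  obtain ⟨hkm, -, hjk, -, -, -, -, -, hmj, -⟩ := hd.lens F
  rw [hij] at hkm
  rw [him] at hjk
  rw [hik] at hmj
  obtain ⟨H, p1, p2, q1, q2, l1, l2, hsupp, hedges⟩ := hR.exists_k4Subdivision hd (b := c) (d := a)
    hs (by omega) hc0 (hij.trans hac.symm) ht hc0 (by omega) (by omega)
  rw [him] at p1
  rw [hRl] at p2
  rw [hmj] at q1
  rw [hik] at q2
  -- each vertex is an inner vertex of `R` or a vertex of the frame off the interior of `seg j k`
  have split : ∀ {x}, (x ∈ H.P₁.support ∨ x ∈ H.L₁.support ∨ x ∈ H.Q₂.support ∨ x ∈ H.Q₁.support ∨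
      x ∈ H.L₂.support ∨ x ∈ H.P₂.support) → (x ∈ R.support ∧ x ≠ s ∧ x ≠ t) ∨
        (x ∈ F.verts ∧ (x ∈ (F.seg j k).support → x = F.u j ∨ x = F.u k)) := by
    intro x hx
    have on : ∀ e f, e ≠ f → ¬ ((e = j ∧ f = k) ∨ (e = k ∧ f = j)) → x ∈ (F.seg e f).support →
        (x ∈ F.verts ∧ (x ∈ (F.seg j k).support → x = F.u j ∨ x = F.u k)) := by
      intro e f hef hne h
      refine ⟨⟨e, f, hef, h⟩, fun h' => ?_⟩
      rcases common hef hd.jk h h' with h | h | ⟨n, rfl, -, rfl | rfl⟩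
      exacts [absurd (Or.inl h) hne, absurd (Or.inr h) hne, Or.inl rfl, Or.inr rfl]
    have oij := on i j hd.ij (by rintro (h | h); exacts [hd.ij h.1, hd.ik h.1])
    have okm := on k m hd.km (by rintro (h | h); exacts [hd.jk h.1.symm, hd.jm h.2.symm])
    rcases hsupp x hx with h | h | h | h | h | h
    · by_cases h1 : x = s
      · exact Or.inr (oij (h1 ▸ hs.mem))
      by_cases h2 : x = t
      · exact Or.inr (okm (h2 ▸ ht.mem))
      exact Or.inl ⟨h, h1, h2⟩
    · exact Or.inr (oij h)
    · exact Or.inr (okm h)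
    · exact Or.inr (on i m hd.im (by rintro (h | h); exacts [hd.ij h.1, hd.ik h.1]) h)
    · exact Or.inr (on m j hd.jm.symm (by rintro (h | h); exacts [hd.jk h.2, hd.km h.1.symm]) h)
    · exact Or.inr (on i k hd.ik (by rintro (h | h); exacts [hd.ij h.1, hd.ik h.1]) h)
  have hind : ∀ i j k m x y, i < j → k < m → x ∈ (H.arris i j).support →
      y ∈ (H.arris k m).support → G.Adj x y → ∃ e f, e ≠ f ∧ s(x, y) ∈ (H.arris e f).edges := by
    intro i₁ i₂ i₃ i₄ x y h12 h34 hx hy hxy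
    have inner : ∀ {x y}, (x ∈ R.support ∧ x ≠ s ∧ x ≠ t) → (y ∈ R.support ∨ y ∈ F.verts) →
        G.Adj x y → s(x, y) ∈ R.edges := by
      rintro x y ⟨h1, h2, h3⟩ hy hxy
      refine hR.ind.mem_edges h1 ?_ hxy
      rcases hy with hy | hy
      · exact hy
      rcases hR.nbr x h1 h2 h3 y hy hxy with rfl | rfl | h
      exacts [R.start_mem_support, R.end_mem_support, h.elim]
    have weak : ∀ {x}, (x ∈ R.support ∧ x ≠ s ∧ x ≠ t) ∨
        (x ∈ F.verts ∧ (x ∈ (F.seg j k).support → x = F.u j ∨ x = F.u k)) →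
        x ∈ R.support ∨ x ∈ F.verts := fun h => h.imp And.left And.left
    rcases split (H.mem_of_mem_arris h12 hx) with hx | hx
    · exact hedges _ (Or.inl (inner hx (weak (split (H.mem_of_mem_arris h34 hy))) hxy))
    rcases split (H.mem_of_mem_arris h34 hy) with hy | hy
    · exact hedges _ (Or.inl (Sym2.eq_swap ▸ inner hy (Or.inr hx.1) hxy.symm))
    rcases mem_edges_of_adj hd hx.1 hy.1 hxy with h | h | h | h | h | h
    iterate 5 exact hedges _ (by simp only [h, true_or, or_true])
    -- the ends of `seg j k` are not adjacent
    exfalso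
    have hjk : ¬ G.Adj (F.u j) (F.u k) := fun h => by
      rw [len_eq_one_of_adj hd.jk h] at hjk
      omega
    rcases hx.2 (Walk.fst_mem_support_of_mem_edges _ h) with rfl | rfl <;>
      rcases hy.2 (Walk.snd_mem_support_of_mem_edges _ h) with rfl | rfl
    exacts [hxy.ne rfl, hjk hxy, hjk hxy.symm, hxy.ne rfl]
  obtain ⟨F', hF2, hF3⟩ := H.exists_frame l (by rw [p1, q1, l1]; omega)
    (by rw [p1, l2, q2]; omega) (by rw [q1, p2, l2]; omega) (by rw [l1, p2, q2]; omega) hind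
  exact false_of_len_lt hl hG hcrit F' (i := 0) (j := 1) (k := 2) (m := 3)
    (by constructor <;> decide) (by rw [hF2, l1]; omega) (by rw [hF3, q2]; omega)

/-- The jump has length `l` by `Jump.opposite`. Its first end is not adjacent to both `u i` and
`u j`, so `Jump.false_of_opposite` applies with `u i` or `u j` as the first branch vertex. -/
theorem Jump.not_opposite (hl : 4 ≤ l) (hG : InFamily l G) (hcrit : IsVertexCritical 4 G)
    {s t : V} {R : G.Walk s t} (hR : F.Jump ∅ R) {i j k m : Fin 4}
    (hd : Distinct i j k m) (hij : F.len i j = l) (him : F.len i m = l) (hik : F.len i k = 1)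
    {a c : ℕ} (hs : F.At i j a s) (ha0 : 0 < a) (ha : a < F.len i j) (ht : F.At k m c t)
    (hc0 : 0 < c) (hc : c < F.len k m) : False := by
  obtain ⟨e1, e2, e3, e4, e5, e6, e7, e8, e9, e10⟩ := hd.lens F
  have h2 := hR.two_le
  rcases hR.opposite hG hd hs ha0 ha ht hc0 hc with ⟨h1, hac⟩ | ⟨h1, hac⟩
  · by_cases ha2 : 2 ≤ a
    · exact hR.false_of_opposite hl hG hcrit (by omega) hd hij him hik hs ha2 ht hc0 (by omega)
    · exact hR.false_of_opposite hl hG hcrit (by omega)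
        ⟨hd.ij.symm, hd.jm, hd.jk, hd.im, hd.ik, hd.km.symm⟩ (by omega) (by omega) (by omega)
        (hs.symm' (b := c) (by omega)) (by omega) (ht.symm' (b := a) (by omega)) ha0 (by omega)
  · omega

/-- With two lengths equal to `l` the third one is `1`. A minimal jump that starts at distance at
least `2` from the ends of `seg i j` is not clean, and the clean jump from its exceptional neighbour
leads to the configuration of `Jump.no_star_of_len_eq_one`. -/
theorem false_of_len_eq (hl : 4 ≤ l) (hG : InFamily l G) (hcrit : IsVertexCritical 4 G)
    (F : Frame G l) {i j k m : Fin 4} (hd : Distinct i j k m) (hij : F.len i j = l)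
    (him : F.len i m = l) : False := by
  obtain ⟨e1, e2, e3, e4, e5, e6, e7, e8, e9, e10⟩ := hd.lens F
  have hik : F.len i k = 1 := by omega
  have hclean : ∀ {b x y}, F.At i j b x → 0 < b → b < l → ∀ R : G.Walk x y, F.Jump ∅ R →
      (b = 1 ∧ F.At i m 1 y) ∨ (b + 1 = l ∧ F.At j k 1 y) := by
    intro b x y hx h0 hb R hR
    rcases hR.classify_of_mem hG hd hx.mem with ⟨a, c, h1, h2, h3, h4, h5, h6⟩ |
      ⟨i', j', k', m', hd', h1, h2, h3⟩
    · exact (hR.not_opposite hl hG hcrit hd hij him hik h1 h2 h3 h4 h5 h6).elim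
    have hij' : (i = i' ∧ j = j') ∨ (i = j' ∧ j = i') := by
      by_contra h
      exact hx.notMem hd.ij hd'.ij h0 (by omega) h h1.mem
    rcases hij' with ⟨rfl, rfl⟩ | ⟨rfl, rfl⟩
    · left
      refine ⟨hx.unique h1, ?_⟩
      rcases hd.eq_or k' with rfl | rfl | rfl | rfl
      · exact absurd rfl hd'.ik
      · exact absurd rfl hd'.jk
      · omega
      · exact h2
    · right
      refine ⟨?_, ?_⟩
      · have := hx.unique (h1.symm' (b := l - 1) (by omega))
        omega
      rcases hd.eq_or k' with rfl | rfl | rfl | rfl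
      · exact absurd rfl hd'.jk
      · exact absurd rfl hd'.ik
      · exact h2
      · omega
  obtain ⟨a, s, t, h1, h2, hs, ⟨R, hR⟩ | ⟨z, b, hab, hz, ⟨R, hR⟩, h⟩⟩ :=
    exists_minimal_jump (F := F) hl hG hcrit hd (lo := 2) (hi := l - 2) two_pos (by omega)
      (by omega)
  · rcases hclean hs (by omega) (by omega) R hR with h | h <;> omega
  rcases h with hzt | ⟨R', hR'⟩
  · exact hR.not_adj_of_at hG hd hs hz hab (by omega) (by omega) hzt
  rcases hclean hz (by omega) (by omega) R' hR' with ⟨rfl, ht⟩ | ⟨hb, ht⟩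
  · obtain rfl : a = 2 := by omega
    exact hR.no_star_of_len_eq_one hG hl hd hij him hz hs ht
  · exact hR.no_star_of_len_eq_one hG hl (i := j) (j := i) (k := m) (m := k)
      ⟨hd.ij.symm, hd.jm, hd.jk, hd.im, hd.ik, hd.km.symm⟩ (by omega) (by omega)
      (hz.symm' (b := 1) (by omega)) (hs.symm' (b := 2) (by omega)) ht

/-- The sum of the three lengths of a frame is `2l + 1`, so either two of them are below `l` or two
of them are `l`. -/
theorem not_nonempty (hl : 4 ≤ l) (hG : InFamily l G) (hcrit : IsVertexCritical 4 G) :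
    ¬ Nonempty (Frame G l) := by
  rintro ⟨F⟩
  have hd : Distinct 0 1 2 3 := by constructor <;> decide
  have h1 := len_le (F := F) hG hd.ij
  have h2 := len_le (F := F) hG hd.ik
  have h3 := len_le (F := F) hG hd.im
  rcases h1.lt_or_eq with h1 | h1 <;> rcases h2.lt_or_eq with h2 | h2 <;>
    rcases h3.lt_or_eq with h3 | h3
  · exact false_of_len_lt hl hG hcrit F hd h2 h3
  · exact false_of_len_lt hl hG hcrit F (i := 0) (j := 3) (k := 1) (m := 2)
      (by constructor <;> decide) h1 h2
  · exact false_of_len_lt hl hG hcrit F hd.swap_mid h1 h3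
  · exact false_of_len_eq hl hG hcrit F hd.swap_mid h2 h3
  · exact false_of_len_lt hl hG hcrit F hd h2 h3
  · exact false_of_len_eq hl hG hcrit F hd h1 h3
  · exact false_of_len_eq hl hG hcrit F hd.swap_right h1 h2
  · exact false_of_len_eq hl hG hcrit F hd h1 h3

end Frame

end OddK4

theorem theorem3p2 (l : ℕ) (hl : 4 ≤ l) {V : Type*} [Finite V] (G : SimpleGraph V)
    (hG : OddK4.InFamily l G) (hcrit : OddK4.IsVertexCritical 4 G) :
    ¬ ∃ H : OddK4.K4Subdivision G, H.IsOdd :=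
  fun ⟨H, hH⟩ => OddK4.Frame.not_nonempty hl hG hcrit (H.nonempty_frame (by omega) hG hH)
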